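/- Let $w_r(x)=\frac{1}{\sqrt{2\pi}\,r}e^{-x^2/(2r^2)}$ be the density of $\mathcal N(0,r^2)$. For a probability distribution $f^*$ on $\mathbb R$ let $f_r(x)=\mathbb E_{Y\sim f^*}[w_r(x-Y)]$ be the density of its $r$-smoothed version $f^* * \mathcal N(0,r^2)$, let $s_r=f_r'/f_r$ be its score and $\mathcal I_r=\mathbb E_{x\sim f_r}[s_r(x)^2]$ its Fisher information. For samples $Y_1,\dots,Y_N$ let $\widehat f_r(x)=\frac1N\sum_{i=1}^N w_r(x-Y_i)$ be the kernel density estimate and $\widehat s_r=\widehat f_r'/\widehat f_r$ its score. For $\delta\in(0,1)$ let $$\widehat s_r^{\,\mathrm{clip}}(x)=\operatorname{sign}(\widehat s_r(x))\cdot\min\Big(|\widehat s_r(x)|,\ \tfrac2r\sqrt{\log\tfrac{N}{\log(1/\delta)}}\Big),$$ and, for a symmetrization point $y$, let $\widehat s_r^{\,\mathrm{sym}}(x)=\widehat s_r^{\,\mathrm{clip}}(x)$ if $x\ge y$ and $\widehat s_r^{\,\mathrm{sym}}(x)=-\widehat s_r^{\,\mathrm{clip}}(2y-x)$ if $x<y$.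 **Lemma (Symmetrized clipped KDE score mean).** For every $\delta_0\in(0,1)$ there are constants $C,K>0$, depending only on $\delta_0$, such that the following holds. Let $f^*$ be any probability distribution on $\mathbb R$ with mean $\mu$ and finite variance $\sigma^2$ (where $\sigma > 0$) that is symmetric about $\mu$. Let $N\in\mathbb N$, $0<r\le\sigma$, $0<\delta\le\delta_0$, $\gamma>C$, $\beta>0$ and $\varepsilon\in\mathbb R$ satisfy $$\frac{N}{\log(1/\delta)}\ \ge\ \Big(\frac{\gamma^{5/12}\sigma}{r}\Big)^{6+\beta},\qquad |\varepsilon|\le\frac r{60},\qquad |\varepsilon|\le r^2\sqrt{\frac{\mathcal I_r}{\gamma}} .$$ Let $Y_1,\dots,Y_N$ be independent samples from $f^*$ and let $\widehat s_r^{\,\mathrm{sym}}$ be symmetrized around $\mu+\varepsilon$. Then, with probability at least $1-\delta$ over the samples, $$\Big|\mathbb E_{x\sim f_r}\big[\widehat s_r^{\,\mathrm{sym}}(x)\big]-\varepsilon\,\mathcal I_r\Big|\ \le\ K\,\frac{|\varepsilon|\,\mathcal I_r}{\sqrt\gamma}.$$ -/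

import Mathlib

open MeasureTheory ProbabilityTheory
open scoped ENNReal NNReal

noncomputable section

namespace SymKDE

/-- The density `w_r` of the normal distribution `N(0, r²)`. -/
def gaussKernel (r x : ℝ) : ℝ := gaussianPDFReal 0 (Real.toNNReal (r ^ 2)) x

/-- The density `f_r(x) = E_{Y ∼ P}[w_r(x - Y)]` of the `r`-smoothed version of `P`. -/
def smoothedDensity (P : Measure ℝ) (r x : ℝ) : ℝ := ∫ y, gaussKernel r (x - y) ∂P

/-- The `r`-smoothed version of `P`, as a measure on `ℝ`. -/
def smoothedLaw (P : Measure ℝ) (r : ℝ) : Measure ℝ :=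
  volume.withDensity fun x => ENNReal.ofReal (smoothedDensity P r x)

/-- The score `f' / f` of a density `f`. -/
def score (f : ℝ → ℝ) (x : ℝ) : ℝ := deriv f x / f x

/-- The Fisher information `𝓘_r = E_{x ∼ f_r}[s_r(x)²]` of the `r`-smoothed version of `P`. -/
def smoothedFisherInfo (P : Measure ℝ) (r : ℝ) : ℝ :=
  ∫ x, (score (smoothedDensity P r) x) ^ 2 ∂(smoothedLaw P r)

/-- The kernel density estimate from the samples `Y₁, …, Y_N`. -/
def kde {N : ℕ} (Y : Fin N → ℝ) (r x : ℝ) : ℝ := (1 / (N : ℝ)) * ∑ i, gaussKernel r (x - Y i)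

/-- The kernel density estimate score, clipped at `(2 / r) √(log (N / log (1 / δ)))`. -/
def clippedScore {N : ℕ} (Y : Fin N → ℝ) (r δ x : ℝ) : ℝ :=
  Real.sign (score (kde Y r) x) *
    min |score (kde Y r) x| (2 / r * √(Real.log ((N : ℝ) / Real.log (1 / δ))))

/-- The clipped kernel density estimate score, symmetrized around the point `y`. -/
def symScore {N : ℕ} (Y : Fin N → ℝ) (r δ y x : ℝ) : ℝ :=
  if y ≤ x then clippedScore Y r δ x else -clippedScore Y r δ (2 * y - x)

end SymKDE

end

/-! Write `ψ` for the clipped estimated score, `s`, `f`, `I` for the true score, density and Fisher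
information, and `y = μ + ε`. Reflecting the half-line below `y` and using the symmetry of `f` about
`μ`, the mean of the symmetrized score becomes `∫_{x ≥ y} ψ(x) (f(x) - f(x - 2ε)) dx`
(`integral_symmetrized`). The difference of densities is already of order `ε`, so a rough estimate
of `s` by `ψ` suffices.

Write `f(x) - f(x - 2ε) = Δ f` with `Δ = 2ε s + ρ`. Then `ψ Δ = (ψ - s) Δ + s ρ + 2ε s²`, and `2ε
∫_{x ≥ μ} s² f = ε I` is the main term. Three errors remain (`abs_integral_symmetrized_sub_le`): the
first is at most `‖ψ - s‖ ‖Δ‖` in `L²(f)`; the second is of order `√I ε² / r²`, because `ρ` is a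
second-order Taylor remainder; moving the endpoint from `μ` to `y` costs the same order, because `s²
f` is at most of order `√I / r²`. The hypothesis `|ε| ≤ r² √(I / γ)` turns `√I ε² / r²` into `|ε| I
/ √γ` and gives `‖Δ‖² ≤ 40 ε² I`.

It remains to show that `‖ψ - s‖²` is of order `I / γ`. Since `I ≥ 1 / (4σ²)`
(`one_le_mul_smoothedFisherInfo`), a bound of order `1 / (γ σ²)` is enough. Put `q = (N /
log(1/δ))^(1/24)`. Where `r f ≥ q⁻²²`, Bernstein's inequality makes the estimated score accurate at
each fixed point, except with probability `4 exp(-N q⁻²³)`; Fubini and Markov then show that the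
exceptional points have small `f`-mass with probability at least `1 - δ`, with no uniform control in
`x`. On the exceptional points, at low density and far from `μ`, the clipping level, the exponential
moment of `r² s²` and Chebyshev's inequality bound the error (`integral_sq_clippedScore_sub_le`). -/

namespace SymKDE

/-! ### The Gaussian kernel -/

/-- The first derivative of the Gaussian kernel. -/
noncomputable def gaussKernelDeriv (r x : ℝ) : ℝ := -(x / r ^ 2) * gaussKernel r x

/-- The second derivative of the Gaussian kernel. -/
noncomputable def gaussKernelDeriv2 (r x : ℝ) : ℝ := (x ^ 2 / r ^ 4 - 1 / r ^ 2) * gaussKernel r x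

section Kernel

variable {r : ℝ}

lemma gaussKernel_eq (hr : 0 < r) (x : ℝ) :
    gaussKernel r x = (√(2 * Real.pi) * r)⁻¹ * Real.exp (-(x ^ 2 / (2 * r ^ 2))) := by
  rw [gaussKernel, gaussianPDFReal, Real.coe_toNNReal _ (sq_nonneg r), sub_zero, neg_div,
    Real.sqrt_mul (by positivity), Real.sqrt_sq hr.le]

lemma gaussKernel_pos (hr : 0 < r) (x : ℝ) : 0 < gaussKernel r x := by
  rw [gaussKernel_eq hr]; positivity

lemma two_le_sqrt_two_pi : 2 ≤ √(2 * Real.pi) := by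
  apply Real.le_sqrt_of_sq_le
  nlinarith [Real.pi_gt_three]

lemma gaussKernel_const_le (hr : 0 < r) : (√(2 * Real.pi) * r)⁻¹ ≤ 1 / (2 * r) := by
  rw [one_div]
  gcongr
  exact two_le_sqrt_two_pi

lemma gaussKernel_le (hr : 0 < r) (x : ℝ) : gaussKernel r x ≤ 1 / (2 * r) := by
  rw [gaussKernel_eq hr]
  calc _ ≤ (√(2 * Real.pi) * r)⁻¹ * 1 := by
        gcongr
        rw [Real.exp_le_one_iff]
        have : 0 ≤ x ^ 2 / (2 * r ^ 2) := by positivity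
        linarith
    _ ≤ _ := by rw [mul_one]; exact gaussKernel_const_le hr

lemma hasDerivAt_gaussKernel (hr : 0 < r) (x : ℝ) :
    HasDerivAt (gaussKernel r) (gaussKernelDeriv r x) x := by
  have h : gaussKernel r =
      fun x => (√(2 * Real.pi) * r)⁻¹ * Real.exp (-(x ^ 2 / (2 * r ^ 2))) := by
    ext x; exact gaussKernel_eq hr x
  rw [gaussKernelDeriv, h]
  refine ((((hasDerivAt_id x).pow 2).div_const (2 * r ^ 2)).neg.exp.const_mul
    ((√(2 * Real.pi) * r)⁻¹)).congr_deriv ?_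
  simp
  field_simp

lemma continuous_gaussKernel (hr : 0 < r) : Continuous (gaussKernel r) :=
  continuous_iff_continuousAt.2 fun x => (hasDerivAt_gaussKernel hr x).continuousAt

lemma continuous_gaussKernelDeriv (hr : 0 < r) : Continuous (gaussKernelDeriv r) := by
  have := continuous_gaussKernel hr
  unfold gaussKernelDeriv
  fun_prop

lemma continuous_gaussKernelDeriv2 (hr : 0 < r) : Continuous (gaussKernelDeriv2 r) := by
  have := continuous_gaussKernel hr
  unfold gaussKernelDeriv2
  fun_prop

lemma hasDerivAt_gaussKernelDeriv (hr : 0 < r) (x : ℝ) :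
    HasDerivAt (gaussKernelDeriv r) (gaussKernelDeriv2 r x) x := by
  have h := (((hasDerivAt_id x).div_const (r ^ 2)).neg.mul (hasDerivAt_gaussKernel hr x))
  refine HasDerivAt.congr_deriv (f := gaussKernelDeriv r) h ?_
  simp only [gaussKernelDeriv, gaussKernelDeriv2, id]
  simp
  field_simp
  ring

/-- `z² w(z) ≤ r / 2`. -/
lemma sq_mul_gaussKernel_le (hr : 0 < r) (z : ℝ) : z ^ 2 * gaussKernel r z ≤ r / 2 := by
  rw [gaussKernel_eq hr]
  set u := z ^ 2 / (2 * r ^ 2) with hu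
  have hz : z ^ 2 = 2 * r ^ 2 * u := by rw [hu]; field_simp
  have h1 : 2 * u * Real.exp (-u) ≤ 1 := by
    have h2 : 2 * u ≤ Real.exp u := by
      have := Real.add_one_le_exp (u - 1)
      have h3 : Real.exp u = Real.exp (u - 1) * Real.exp 1 := by rw [← Real.exp_add]; ring_nf
      have h4 := Real.exp_one_gt_d9
      have h5 : 0 ≤ u := by positivity
      rw [h3]; nlinarith [Real.exp_pos (u - 1)]
    calc 2 * u * Real.exp (-u) ≤ Real.exp u * Real.exp (-u) := by gcongr
      _ = 1 := by rw [← Real.exp_add]; simp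
  have h2 := gaussKernel_const_le hr
  calc z ^ 2 * ((√(2 * Real.pi) * r)⁻¹ * Real.exp (-u))
      = r ^ 2 * (√(2 * Real.pi) * r)⁻¹ * (2 * u * Real.exp (-u)) := by rw [hz]; ring
    _ ≤ r ^ 2 * (1 / (2 * r)) * 1 := by
        have : 0 ≤ u := by positivity
        gcongr
    _ = r / 2 := by field_simp

lemma abs_gaussKernelDeriv_le (hr : 0 < r) (z : ℝ) : |gaussKernelDeriv r z| ≤ 1 / (2 * r ^ 2) := by
  apply abs_le_of_sq_le_sq _ (by positivity)
  have h1 := sq_mul_gaussKernel_le hr z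
  have h2 := gaussKernel_le hr z
  have h3 := gaussKernel_pos hr z
  calc (gaussKernelDeriv r z) ^ 2 = (z ^ 2 * gaussKernel r z) * gaussKernel r z / r ^ 4 := by
        rw [gaussKernelDeriv]; ring
    _ ≤ (r / 2) * (1 / (2 * r)) / r ^ 4 := by gcongr
    _ = (1 / (2 * r ^ 2)) ^ 2 := by field_simp

lemma abs_gaussKernelDeriv2_le (hr : 0 < r) (z : ℝ) : |gaussKernelDeriv2 r z| ≤ 1 / (2 * r ^ 3) := by
  have h1 := sq_mul_gaussKernel_le hr z
  have h2 := gaussKernel_le hr z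
  have h3 := gaussKernel_pos hr z
  have e : gaussKernelDeriv2 r z = z ^ 2 * gaussKernel r z / r ^ 4 - gaussKernel r z / r ^ 2 := by
    rw [gaussKernelDeriv2]; ring
  have a1 : z ^ 2 * gaussKernel r z / r ^ 4 ≤ 1 / (2 * r ^ 3) := by
    calc _ ≤ (r / 2) / r ^ 4 := by gcongr
      _ = _ := by field_simp
  have a2 : gaussKernel r z / r ^ 2 ≤ 1 / (2 * r ^ 3) := by
    calc _ ≤ (1 / (2 * r)) / r ^ 2 := by gcongr
      _ = _ := by field_simp
  have a3 : 0 ≤ z ^ 2 * gaussKernel r z / r ^ 4 := by positivity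
  have a4 : 0 ≤ gaussKernel r z / r ^ 2 := by positivity
  rw [e, abs_le]; constructor <;> linarith

lemma integrable_gaussKernel : Integrable (gaussKernel r) := integrable_gaussianPDFReal _ _

lemma integral_gaussKernel (hr : 0 < r) : ∫ x, gaussKernel r x = 1 :=
  integral_gaussianPDFReal_eq_one _ (by simpa using hr.ne')

lemma integrable_sq_mul_gaussKernel (hr : 0 < r) :
    Integrable fun x => x ^ 2 * gaussKernel r x := by
  have h0 : Real.toNNReal (r ^ 2) ≠ 0 := by simpa using hr.ne'
  have h := (memLp_id_gaussianReal (μ := 0) (v := Real.toNNReal (r ^ 2)) 2).integrable_sq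
  rw [gaussianReal_of_var_ne_zero _ h0] at h
  rw [gaussianPDF_def, integrable_withDensity_iff_integrable_smul' (by fun_prop) (by simp)] at h
  refine h.congr (Filter.Eventually.of_forall fun x => ?_)
  simp [gaussKernel, gaussianPDFReal_nonneg]
  ring

lemma integral_sq_mul_gaussKernel (hr : 0 < r) :
    ∫ x, x ^ 2 * gaussKernel r x = r ^ 2 := by
  have h0 : Real.toNNReal (r ^ 2) ≠ 0 := by simpa using hr.ne'
  have h := variance_id_gaussianReal (μ := 0) (v := Real.toNNReal (r ^ 2))
  rw [variance_eq_integral (by fun_prop), integral_gaussianReal_eq_integral_smul h0] at h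
  simp only [id, integral_id_gaussianReal, Real.coe_toNNReal _ (sq_nonneg r), smul_eq_mul,
    sub_zero] at h
  rw [← h]
  congr 1; ext x; rw [gaussKernel]; ring

lemma integrable_mul_gaussKernel (hr : 0 < r) :
    Integrable fun x => x * gaussKernel r x := by
  have hc := continuous_gaussKernel hr
  refine Integrable.mono' ((integrable_gaussKernel (r := r)).add (integrable_sq_mul_gaussKernel hr))
    (by fun_prop) (Filter.Eventually.of_forall fun x => ?_)
  have := gaussKernel_pos hr x
  rw [norm_mul, Real.norm_eq_abs, Real.norm_eq_abs, abs_of_pos this]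
  simp only [Pi.add_apply]
  have : |x| ≤ 1 + x ^ 2 := by
    rw [abs_le]; constructor <;> nlinarith [sq_nonneg (x - 1), sq_nonneg (x + 1)]
  nlinarith

lemma integral_mul_gaussKernel (hr : 0 < r) :
    ∫ x, x * gaussKernel r x = 0 := by
  have h0 : Real.toNNReal (r ^ 2) ≠ 0 := by simpa using hr.ne'
  have h := integral_id_gaussianReal (μ := 0) (v := Real.toNNReal (r ^ 2))
  rw [integral_gaussianReal_eq_integral_smul h0] at h
  rw [← h]
  congr 1; ext x; rw [gaussKernel, smul_eq_mul]; ring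

/-- The factor cancels half of the Gaussian exponent, which doubles the variance. This is why the
exponential moments below carry the constant `1/4` and the value `√2`. -/
lemma exp_mul_gaussKernel (hr : 0 < r) (z : ℝ) :
    Real.exp (z ^ 2 / (4 * r ^ 2)) * gaussKernel r z = √2 * gaussKernel (√2 * r) z := by
  have h2 : (√2) ^ 2 = 2 := Real.sq_sqrt (by norm_num)
  rw [gaussKernel_eq hr, gaussKernel_eq (by positivity), mul_pow, h2, mul_left_comm,
    ← Real.exp_add, ← mul_assoc √2]
  congr 1
  · field_simp
  · congr 1; field_simp; ring

lemma integrable_exp_mul_gaussKernel (hr : 0 < r) :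
    Integrable fun z => Real.exp (z ^ 2 / (4 * r ^ 2)) * gaussKernel r z := by
  simp_rw [exp_mul_gaussKernel hr]
  exact integrable_gaussKernel.const_mul _

lemma integral_exp_mul_gaussKernel (hr : 0 < r) :
    ∫ z, Real.exp (z ^ 2 / (4 * r ^ 2)) * gaussKernel r z = √2 := by
  simp_rw [exp_mul_gaussKernel hr]
  rw [integral_const_mul, integral_gaussKernel (by positivity), mul_one]

/-- Completing the square. This is the only non-polynomial term in the squared Taylor remainder of
the kernel. -/
lemma gaussKernel_shift_sq_div (hr : 0 < r) (h z : ℝ) :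
    gaussKernel r (z - h) ^ 2 / gaussKernel r z
      = Real.exp (h ^ 2 / r ^ 2) * gaussKernel r (z - 2 * h) := by
  rw [div_eq_iff (gaussKernel_pos hr z).ne']
  simp only [gaussKernel_eq hr]
  rw [mul_pow, ← Real.exp_nat_mul]
  have : ∀ a b c d : ℝ, a * (b * c) * (b * d) = b ^ 2 * (a * c * d) := by intros; ring
  rw [this, ← Real.exp_add, ← Real.exp_add]
  congr 2
  push_cast
  field_simp
  ring

end Kernel

/-! ### Convolution of a function with a measure -/

section Convolution

variable {P : Measure ℝ} [IsProbabilityMeasure P] {g φ φ' : ℝ → ℝ}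

lemma integrable_prod_translate (hg : Integrable g P) (hφ : Integrable φ) :
    Integrable (fun p : ℝ × ℝ => g p.2 * φ (p.1 - p.2)) (volume.prod P) :=
  Integrable.convolution_integrand (ContinuousLinearMap.mul ℝ ℝ) hg hφ

lemma integrable_translate (hg : Integrable g P) (hφ : Integrable φ) :
    Integrable (fun x => ∫ y, g y * φ (x - y) ∂P) :=
  (integrable_prod_translate hg hφ).integral_prod_left

lemma integral_translate (hg : Integrable g P) (hφ : Integrable φ) :
    ∫ x, ∫ y, g y * φ (x - y) ∂P = (∫ y, g y ∂P) * ∫ z, φ z := by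
  rw [integral_integral_swap (integrable_prod_translate hg hφ), ← integral_mul_const]
  refine integral_congr_ae (Filter.Eventually.of_forall fun y => ?_)
  simp only
  rw [integral_const_mul, integral_sub_right_eq_self φ y]

lemma ae_integrable_translate (hg : Integrable g P) (hφ : Integrable φ) :
    ∀ᵐ x, Integrable (fun y => g y * φ (x - y)) P :=
  (integrable_prod_translate hg hφ).prod_right_ae

lemma integrable_translate_one (hφ : Integrable φ) :
    Integrable (fun x => ∫ y, φ (x - y) ∂P) := by
  simpa using integrable_translate (P := P) (integrable_const (1 : ℝ)) hφ

lemma integral_translate_one (hφ : Integrable φ) :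
    ∫ x, ∫ y, φ (x - y) ∂P = ∫ z, φ z := by
  simpa using integral_translate (P := P) (integrable_const (1 : ℝ)) hφ

lemma ae_integrable_translate_one (hφ : Integrable φ) :
    ∀ᵐ x, Integrable (fun y => φ (x - y)) P := by
  simpa using ae_integrable_translate (P := P) (integrable_const (1 : ℝ)) hφ

lemma integrable_translate_of_bounded (hc : Continuous φ) {B : ℝ} (hb : ∀ z, |φ z| ≤ B) (x : ℝ) :
    Integrable (fun y => φ (x - y)) P :=
  Integrable.of_bound (by fun_prop) B (Filter.Eventually.of_forall fun y => hb _)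

lemma hasDerivAt_integral_translate (hφ : ∀ x, HasDerivAt φ (φ' x) x) (hc : Continuous φ')
    {B B' : ℝ} (hb : ∀ z, |φ z| ≤ B) (hb' : ∀ z, |φ' z| ≤ B') (x : ℝ) :
    HasDerivAt (fun x => ∫ y, φ (x - y) ∂P) (∫ y, φ' (x - y) ∂P) x := by
  have hcφ : Continuous φ := continuous_iff_continuousAt.2 fun x => (hφ x).continuousAt
  refine (hasDerivAt_integral_of_dominated_loc_of_deriv_le (bound := fun _ => B')
    (F := fun x y => φ (x - y)) (F' := fun x y => φ' (x - y)) Filter.univ_mem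
    (Filter.Eventually.of_forall fun x => by fun_prop)
    (integrable_translate_of_bounded hcφ hb x) (by fun_prop)
    (Filter.Eventually.of_forall fun y x _ => hb' _) (integrable_const _)
    (Filter.Eventually.of_forall fun y x _ => ?_)).2
  exact (hφ (x - y)).comp_sub_const x y

lemma continuous_integral_translate (hc : Continuous φ) {B : ℝ} (hb : ∀ z, |φ z| ≤ B) :
    Continuous (fun x => ∫ y, φ (x - y) ∂P) :=
  continuous_of_dominated (fun x => by fun_prop)
    (fun x => Filter.Eventually.of_forall fun y => hb _) (integrable_const B)
    (Filter.Eventually.of_forall fun y => by fun_prop)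

end Convolution

/-! ### The smoothed density and its derivatives -/

/-- The first derivative of the smoothed density. -/
noncomputable def smoothedDeriv (P : Measure ℝ) (r x : ℝ) : ℝ := ∫ y, gaussKernelDeriv r (x - y) ∂P

/-- The second derivative of the smoothed density. -/
noncomputable def smoothedDeriv2 (P : Measure ℝ) (r x : ℝ) : ℝ :=
  ∫ y, gaussKernelDeriv2 r (x - y) ∂P

/-- The score of the smoothed density. -/
noncomputable abbrev smoothedScore (P : Measure ℝ) (r : ℝ) : ℝ → ℝ := score (smoothedDensity P r)

section Density

variable {P : Measure ℝ} [IsProbabilityMeasure P] {r : ℝ}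

lemma abs_gaussKernel_le (hr : 0 < r) (x : ℝ) : |gaussKernel r x| ≤ 1 / (2 * r) := by
  rw [abs_of_pos (gaussKernel_pos hr x)]; exact gaussKernel_le hr x

lemma integrable_gaussKernel_translate (hr : 0 < r) (x : ℝ) :
    Integrable (fun y => gaussKernel r (x - y)) P :=
  integrable_translate_of_bounded (continuous_gaussKernel hr) (abs_gaussKernel_le hr) x

lemma integrable_gaussKernelDeriv_translate (hr : 0 < r) (x : ℝ) :
    Integrable (fun y => gaussKernelDeriv r (x - y)) P :=
  integrable_translate_of_bounded (continuous_gaussKernelDeriv hr) (abs_gaussKernelDeriv_le hr) x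

lemma hasDerivAt_smoothedDensity (hr : 0 < r) (x : ℝ) :
    HasDerivAt (smoothedDensity P r) (smoothedDeriv P r x) x :=
  hasDerivAt_integral_translate (hasDerivAt_gaussKernel hr) (continuous_gaussKernelDeriv hr)
    (abs_gaussKernel_le hr) (abs_gaussKernelDeriv_le hr) x

lemma hasDerivAt_smoothedDeriv (hr : 0 < r) (x : ℝ) :
    HasDerivAt (smoothedDeriv P r) (smoothedDeriv2 P r x) x :=
  hasDerivAt_integral_translate (hasDerivAt_gaussKernelDeriv hr) (continuous_gaussKernelDeriv2 hr)
    (abs_gaussKernelDeriv_le hr) (abs_gaussKernelDeriv2_le hr) x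

lemma continuous_smoothedDensity (hr : 0 < r) : Continuous (smoothedDensity P r) :=
  continuous_integral_translate (continuous_gaussKernel hr) (abs_gaussKernel_le hr)

lemma continuous_smoothedDeriv (hr : 0 < r) : Continuous (smoothedDeriv P r) :=
  continuous_integral_translate (continuous_gaussKernelDeriv hr) (abs_gaussKernelDeriv_le hr)

lemma continuous_smoothedDeriv2 (hr : 0 < r) : Continuous (smoothedDeriv2 P r) :=
  continuous_integral_translate (continuous_gaussKernelDeriv2 hr) (abs_gaussKernelDeriv2_le hr)

lemma smoothedDensity_pos (hr : 0 < r) (x : ℝ) : 0 < smoothedDensity P r x := by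
  rw [smoothedDensity, integral_pos_iff_support_of_nonneg (fun y => (gaussKernel_pos hr _).le)
    (integrable_gaussKernel_translate hr x)]
  have : (Function.support fun y => gaussKernel r (x - y)) = Set.univ := by
    ext y; simpa using (gaussKernel_pos hr (x - y)).ne'
  rw [this]; simp

lemma integrable_smoothedDensity : Integrable (smoothedDensity P r) :=
  integrable_translate_one integrable_gaussKernel

lemma integral_smoothedDensity (hr : 0 < r) : ∫ x, smoothedDensity P r x = 1 :=
  (integral_translate_one integrable_gaussKernel).trans (integral_gaussKernel hr)

lemma smoothedScore_eq (hr : 0 < r) (x : ℝ) :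
    smoothedScore P r x = smoothedDeriv P r x / smoothedDensity P r x := by
  rw [smoothedScore, score, (hasDerivAt_smoothedDensity hr x).deriv]

lemma smoothedScore_mul (hr : 0 < r) (x : ℝ) :
    smoothedScore P r x * smoothedDensity P r x = smoothedDeriv P r x := by
  rw [smoothedScore_eq hr, div_mul_cancel₀ _ (smoothedDensity_pos hr x).ne']

lemma continuous_smoothedScore (hr : 0 < r) : Continuous (smoothedScore P r) := by
  rw [show smoothedScore P r = fun x => smoothedDeriv P r x / smoothedDensity P r x from
    funext fun x => smoothedScore_eq hr x]
  exact (continuous_smoothedDeriv hr).div (continuous_smoothedDensity hr)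
    fun x => (smoothedDensity_pos hr x).ne'

lemma integral_smoothedLaw (hr : 0 < r) (g : ℝ → ℝ) :
    ∫ x, g x ∂(smoothedLaw P r) = ∫ x, g x * smoothedDensity P r x := by
  have hc := continuous_smoothedDensity (P := P) hr
  rw [smoothedLaw, integral_withDensity_eq_integral_toReal_smul (by fun_prop) (by simp)]
  congr 1; ext x
  rw [ENNReal.toReal_ofReal (smoothedDensity_pos hr x).le, smul_eq_mul, mul_comm]

instance isProbabilityMeasure_smoothedLaw [Fact (0 < r)] :
    IsProbabilityMeasure (smoothedLaw P r) := by
  have hr : 0 < r := Fact.out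
  constructor
  rw [smoothedLaw, withDensity_apply _ MeasurableSet.univ, Measure.restrict_univ,
    ← ofReal_integral_eq_lintegral_ofReal integrable_smoothedDensity
    (Filter.Eventually.of_forall fun x => (smoothedDensity_pos hr x).le),
    integral_smoothedDensity hr, ENNReal.ofReal_one]

/-- Cauchy–Schwarz with respect to the weights `w_r(x - y) dP(y)`. -/
lemma sq_integral_translate_le (hr : 0 < r) {φ : ℝ → ℝ} (hφ : Continuous φ) (x : ℝ)
    (hi : Integrable (fun y => φ (x - y) ^ 2 / gaussKernel r (x - y)) P) :
    (∫ y, φ (x - y) ∂P) ^ 2 / smoothedDensity P r x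
      ≤ ∫ y, φ (x - y) ^ 2 / gaussKernel r (x - y) ∂P := by
  have hw := integrable_gaussKernel_translate (P := P) hr x
  have hi1 : Integrable (fun y => φ (x - y)) P := by
    refine (hi.add hw).mono' (by fun_prop) (Filter.Eventually.of_forall fun y => ?_)
    have hp := gaussKernel_pos hr (x - y)
    simp only [Pi.add_apply, Real.norm_eq_abs]
    rw [div_add' _ _ _ hp.ne', le_div_iff₀ hp, ← sq_abs (φ (x - y))]
    nlinarith [sq_nonneg (|φ (x - y)| - gaussKernel r (x - y)), abs_nonneg (φ (x - y))]
  set A := ∫ y, φ (x - y) ∂P with hA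
  have hf := smoothedDensity_pos (P := P) hr x
  set f := smoothedDensity P r x with hfdef
  set c := A / f with hc
  have h0 : 0 ≤ ∫ y, (φ (x - y) ^ 2 / gaussKernel r (x - y) - 2 * c * φ (x - y)
      + c ^ 2 * gaussKernel r (x - y)) ∂P := by
    refine integral_nonneg fun y => ?_
    have hp := gaussKernel_pos hr (x - y)
    have : φ (x - y) ^ 2 / gaussKernel r (x - y) - 2 * c * φ (x - y)
      + c ^ 2 * gaussKernel r (x - y) =
        (φ (x - y) - c * gaussKernel r (x - y)) ^ 2 / gaussKernel r (x - y) := by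
      field_simp; ring
    simp only [Pi.zero_apply]
    rw [this]; positivity
  have hi2 : Integrable (fun y => φ (x - y) ^ 2 / gaussKernel r (x - y) - 2 * c * φ (x - y)) P :=
    hi.sub (hi1.const_mul _)
  rw [integral_add hi2 (hw.const_mul _), integral_sub hi (hi1.const_mul _),
    integral_const_mul, integral_const_mul] at h0
  change 0 ≤ _ - 2 * c * A + c ^ 2 * f at h0
  have e : -(2 * c * A) + c ^ 2 * f = -(A ^ 2 / f) := by rw [hc]; field_simp; ring
  linarith

lemma integrable_sq_integral_translate_div (hr : 0 < r) {φ : ℝ → ℝ} (hφ : Continuous φ)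
    (hi : Integrable (fun z => φ z ^ 2 / gaussKernel r z)) :
    Integrable (fun x => (∫ y, φ (x - y) ∂P) ^ 2 / smoothedDensity P r x) := by
  have hc := continuous_smoothedDensity (P := P) hr
  have hm : StronglyMeasurable fun x => ∫ y, φ (x - y) ∂P :=
    StronglyMeasurable.integral_prod_right (f := fun x y => φ (x - y))
      (Continuous.stronglyMeasurable (by fun_prop))
  refine Integrable.mono' (integrable_translate_one (P := P) hi)
    ((hm.measurable.pow_const 2).div hc.measurable).aestronglyMeasurable ?_
  filter_upwards [ae_integrable_translate_one (P := P) hi] with x hx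
  have := smoothedDensity_pos (P := P) hr x
  rw [Real.norm_of_nonneg (by positivity)]
  exact sq_integral_translate_le hr hφ x hx

/-- Averaging over `P` cannot increase `∫ φ² / w`, by convexity of `a² / b`. Weighted quadratic
bounds for the smoothed density thus reduce to explicit Gaussian integrals that do not involve `P`.
-/
lemma integral_sq_integral_translate_div_le (hr : 0 < r) {φ : ℝ → ℝ} (hφ : Continuous φ)
    (hi : Integrable (fun z => φ z ^ 2 / gaussKernel r z)) :
    ∫ x, (∫ y, φ (x - y) ∂P) ^ 2 / smoothedDensity P r x ≤ ∫ z, φ z ^ 2 / gaussKernel r z := by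
  rw [← integral_translate_one (P := P) hi]
  refine integral_mono_ae (integrable_sq_integral_translate_div hr hφ hi)
    (integrable_translate_one (P := P) hi) ?_
  filter_upwards [ae_integrable_translate_one (P := P) hi] with x hx
  exact sq_integral_translate_le hr hφ x hx

/-! ### Exponential moments of the score -/

/-- Jensen's inequality for `exp (c z² / r²)` with respect to the weights `w_r(x - y) dP(y)`. -/
lemma exp_score_mul_le (hr : 0 < r) {c : ℝ} (hc : 0 ≤ c) (x : ℝ)
    (hi : Integrable
      (fun y => Real.exp (c * ((x - y) ^ 2 / r ^ 2)) * gaussKernel r (x - y)) P) :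
    Real.exp (c * (r ^ 2 * smoothedScore P r x ^ 2)) * smoothedDensity P r x ≤
      ∫ y, Real.exp (c * ((x - y) ^ 2 / r ^ 2)) * gaussKernel r (x - y) ∂P := by
  set s := smoothedScore P r x with hs
  set E := Real.exp (c * (r ^ 2 * s ^ 2)) with hE
  have hw := integrable_gaussKernel_translate (P := P) hr x
  have hw' := integrable_gaussKernelDeriv_translate (P := P) hr x
  -- The integrand is a minorant of `exp (c z² / r²) w`, affine in `z` up to the factor `w`: the
  -- tangent line of the exponential at `r² s²`, followed by the tangent line of `z² / r²` at `z =
  -- -r² s`. Its integral is exactly `E f` because `f' = s f`.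
  have e : E * smoothedDensity P r x = ∫ y, (E * (1 - 2 * c * (r ^ 2 * s ^ 2)) *
      gaussKernel r (x - y) + E * (2 * c * r ^ 2 * s) * gaussKernelDeriv r (x - y)) ∂P := by
    rw [integral_add (hw.const_mul _) (hw'.const_mul _), integral_const_mul, integral_const_mul]
    change _ = _ * smoothedDensity P r x + _ * smoothedDeriv P r x
    rw [← smoothedScore_mul hr, ← hs]; ring
  rw [e]
  refine integral_mono ((hw.const_mul _).add (hw'.const_mul _)) hi fun y => ?_
  simp only
  have hp := gaussKernel_pos hr (x - y)
  have hEp : 0 < E := Real.exp_pos _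
  set z := x - y with hz
  have h1 : 1 + (c * (z ^ 2 / r ^ 2) - c * (r ^ 2 * s ^ 2)) ≤
      Real.exp (c * (z ^ 2 / r ^ 2) - c * (r ^ 2 * s ^ 2)) := by
    linarith [Real.add_one_le_exp (c * (z ^ 2 / r ^ 2) - c * (r ^ 2 * s ^ 2))]
  have h2 : Real.exp (c * (z ^ 2 / r ^ 2)) =
      E * Real.exp (c * (z ^ 2 / r ^ 2) - c * (r ^ 2 * s ^ 2)) := by
    rw [hE, ← Real.exp_add]; ring_nf
  have h3 : -2 * (s * z) - r ^ 2 * s ^ 2 ≤ z ^ 2 / r ^ 2 := by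
    have : z ^ 2 / r ^ 2 - (-2 * (s * z) - r ^ 2 * s ^ 2) = (z / r + s * r) ^ 2 := by
      field_simp; ring
    nlinarith [sq_nonneg (z / r + s * r)]
  have h4 : 1 - 2 * c * (r ^ 2 * s ^ 2) - 2 * c * (s * z) ≤
      Real.exp (c * (z ^ 2 / r ^ 2) - c * (r ^ 2 * s ^ 2)) := by
    nlinarith
  rw [h2]
  calc _ = E * (1 - 2 * c * (r ^ 2 * s ^ 2) - 2 * c * (s * z)) * gaussKernel r z := by
        rw [gaussKernelDeriv]; field_simp; ring
    _ ≤ _ := by gcongr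

lemma exp_half_mul_gaussKernel (hr : 0 < r) (z : ℝ) :
    Real.exp (1 / 2 * (z ^ 2 / r ^ 2)) * gaussKernel r z = (√(2 * Real.pi) * r)⁻¹ := by
  rw [gaussKernel_eq hr, mul_left_comm, ← Real.exp_add]
  convert mul_one _
  rw [Real.exp_eq_one_iff]; field_simp; ring

/-- The score is at most of order `r⁻¹ √(log (1 / (r f)))`. -/
lemma exp_score_mul_density_le (hr : 0 < r) (x : ℝ) :
    Real.exp (r ^ 2 * smoothedScore P r x ^ 2 / 2) * smoothedDensity P r x ≤ 1 / (2 * r) := by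
  have h := exp_score_mul_le (P := P) hr (c := 1 / 2) (by norm_num) x (by
    simp_rw [exp_half_mul_gaussKernel hr]; exact integrable_const _)
  simp_rw [exp_half_mul_gaussKernel hr] at h
  rw [integral_const, probReal_univ, one_smul] at h
  rw [show r ^ 2 * smoothedScore P r x ^ 2 / 2 = 1 / 2 * (r ^ 2 * smoothedScore P r x ^ 2) by ring]
  exact h.trans (gaussKernel_const_le hr)

lemma exp_quarter_score_mul_density_le (hr : 0 < r) (x : ℝ) :
    Real.exp (r ^ 2 * smoothedScore P r x ^ 2 / 4) * smoothedDensity P r x ≤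
      ∫ y, Real.exp ((x - y) ^ 2 / (4 * r ^ 2)) * gaussKernel r (x - y) ∂P := by
  have e : ∀ z : ℝ, Real.exp (1 / 4 * (z ^ 2 / r ^ 2)) = Real.exp (z ^ 2 / (4 * r ^ 2)) := by
    intro z; congr 1; field_simp
  have h := exp_score_mul_le (P := P) hr (c := 1 / 4) (by norm_num) x (by
    simp_rw [e, exp_mul_gaussKernel hr]
    exact (integrable_gaussKernel_translate (by positivity) x).const_mul _)
  simp_rw [e] at h
  rwa [show r ^ 2 * smoothedScore P r x ^ 2 / 4 = 1 / 4 * (r ^ 2 * smoothedScore P r x ^ 2) by ring]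

lemma integrable_exp_score (hr : 0 < r) : Integrable
    fun x => Real.exp (r ^ 2 * smoothedScore P r x ^ 2 / 4) * smoothedDensity P r x := by
  have h1 := continuous_smoothedDensity (P := P) hr
  have h2 := continuous_smoothedScore (P := P) hr
  refine (integrable_translate_one (P := P) (integrable_exp_mul_gaussKernel hr)).mono'
    (by fun_prop) (Filter.Eventually.of_forall fun x => ?_)
  have := smoothedDensity_pos (P := P) hr x
  rw [Real.norm_of_nonneg (by positivity)]
  exact exp_quarter_score_mul_density_le hr x

/-- Integrating the pointwise Jensen bound leaves a pure Gaussian integral equal to `√2`. Hence `r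
s` has moments of order one, uniformly in `P`. -/
lemma integral_exp_score_le (hr : 0 < r) :
    ∫ x, Real.exp (r ^ 2 * smoothedScore P r x ^ 2 / 4) * smoothedDensity P r x ≤ 3 / 2 := by
  have h := integral_mono (integrable_exp_score (P := P) hr)
    (integrable_translate_one (P := P) (integrable_exp_mul_gaussKernel hr))
    (exp_quarter_score_mul_density_le hr)
  rw [integral_translate_one (integrable_exp_mul_gaussKernel hr),
    integral_exp_mul_gaussKernel hr] at h
  exact h.trans (by rw [Real.sqrt_le_left (by norm_num)]; norm_num)

end Density

/-- The Cauchy–Schwarz inequality for real integrals. -/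
lemma abs_integral_mul_le_sqrt {α : Type*} [MeasurableSpace α] {ν : Measure α} {u v : α → ℝ}
    (hu : AEStronglyMeasurable u ν) (hv : AEStronglyMeasurable v ν)
    (hu2 : Integrable (fun x => u x ^ 2) ν) (hv2 : Integrable (fun x => v x ^ 2) ν) :
    |∫ x, u x * v x ∂ν| ≤ √(∫ x, u x ^ 2 ∂ν) * √(∫ x, v x ^ 2 ∂ν) := by
  have h1 : MemLp (fun x => |u x|) (ENNReal.ofReal 2) ν := by
    simpa using ((memLp_two_iff_integrable_sq hu).2 hu2).norm
  have h2 : MemLp (fun x => |v x|) (ENNReal.ofReal 2) ν := by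
    simpa using ((memLp_two_iff_integrable_sq hv).2 hv2).norm
  have h := integral_mul_le_Lp_mul_Lq_of_nonneg Real.HolderConjugate.two_two
    (Filter.Eventually.of_forall fun x => abs_nonneg (u x))
    (Filter.Eventually.of_forall fun x => abs_nonneg (v x)) h1 h2
  simp only [Real.rpow_two, sq_abs, ← Real.sqrt_eq_rpow] at h
  refine (abs_integral_le_integral_abs).trans (le_trans (le_of_eq ?_) h)
  simp_rw [abs_mul]

lemma integrable_mul_of_sq {α : Type*} [MeasurableSpace α] {ν : Measure α} {u v : α → ℝ}
    (hu : AEStronglyMeasurable u ν) (hv : AEStronglyMeasurable v ν)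
    (hu2 : Integrable (fun x => u x ^ 2) ν) (hv2 : Integrable (fun x => v x ^ 2) ν) :
    Integrable (fun x => u x * v x) ν := by
  refine (hu2.add hv2).mono' (hu.mul hv) (Filter.Eventually.of_forall fun x => ?_)
  rw [norm_mul, Real.norm_eq_abs, Real.norm_eq_abs]
  simp only [Pi.add_apply]
  rw [← sq_abs (u x), ← sq_abs (v x)]
  nlinarith [sq_nonneg (|u x| - |v x|), sq_nonneg (|u x|), sq_nonneg (|v x|)]

/-! ### Polynomial moments of the score and weighted norms of the second derivative. -/

section Moments

variable {P : Measure ℝ} [IsProbabilityMeasure P] {r : ℝ}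

lemma smoothedFisherInfo_eq (hr : 0 < r) :
    smoothedFisherInfo P r = ∫ x, smoothedScore P r x ^ 2 * smoothedDensity P r x :=
  integral_smoothedLaw hr _

lemma integrable_score_sq (hr : 0 < r) :
    Integrable fun x => smoothedScore P r x ^ 2 * smoothedDensity P r x := by
  have h1 := continuous_smoothedDensity (P := P) hr
  have h2 := continuous_smoothedScore (P := P) hr
  refine ((integrable_exp_score (P := P) hr).const_mul (4 / r ^ 2)).mono' (by fun_prop)
    (Filter.Eventually.of_forall fun x => ?_)
  have hf := smoothedDensity_pos (P := P) hr x
  rw [Real.norm_of_nonneg (by positivity), ← mul_assoc]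
  gcongr
  have := Real.add_one_le_exp (r ^ 2 * smoothedScore P r x ^ 2 / 4)
  calc smoothedScore P r x ^ 2 = 4 / r ^ 2 * (r ^ 2 * smoothedScore P r x ^ 2 / 4) := by field_simp
    _ ≤ _ := by gcongr; linarith

lemma score_fourth_mul_le (hr : 0 < r) (x : ℝ) :
    smoothedScore P r x ^ 4 * smoothedDensity P r x ≤
      32 / r ^ 4 * (Real.exp (r ^ 2 * smoothedScore P r x ^ 2 / 4) * smoothedDensity P r x) := by
  have hf := smoothedDensity_pos (P := P) hr x
  rw [← mul_assoc]
  gcongr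
  have h := Real.quadratic_le_exp_of_nonneg (x := r ^ 2 * smoothedScore P r x ^ 2 / 4)
    (by positivity)
  calc smoothedScore P r x ^ 4
      = 32 / r ^ 4 * ((r ^ 2 * smoothedScore P r x ^ 2 / 4) ^ 2 / 2) := by field_simp; ring
    _ ≤ _ := by
      gcongr
      have : 0 ≤ r ^ 2 * smoothedScore P r x ^ 2 / 4 := by positivity
      linarith

lemma integrable_score_fourth (hr : 0 < r) :
    Integrable fun x => smoothedScore P r x ^ 4 * smoothedDensity P r x := by
  have h1 := continuous_smoothedDensity (P := P) hr
  have h2 := continuous_smoothedScore (P := P) hr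
  refine ((integrable_exp_score (P := P) hr).const_mul (32 / r ^ 4)).mono' (by fun_prop)
    (Filter.Eventually.of_forall fun x => ?_)
  have hf := smoothedDensity_pos (P := P) hr x
  rw [Real.norm_of_nonneg (by positivity)]
  exact score_fourth_mul_le hr x

lemma integral_score_fourth_le (hr : 0 < r) :
    ∫ x, smoothedScore P r x ^ 4 * smoothedDensity P r x ≤ 48 / r ^ 4 := by
  calc _ ≤ ∫ x, 32 / r ^ 4 *
        (Real.exp (r ^ 2 * smoothedScore P r x ^ 2 / 4) * smoothedDensity P r x) :=
        integral_mono (integrable_score_fourth hr) ((integrable_exp_score hr).const_mul _)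
          (score_fourth_mul_le hr)
    _ ≤ 32 / r ^ 4 * (3 / 2) := by
        rw [integral_const_mul]
        gcongr
        exact integral_exp_score_le hr
    _ = _ := by ring

/-- With `v = z² / (4r²)` the left side is `r⁻⁴ (4v - 1)² w`, and `(4v - 1)² ≤ 32 (1 + v + v²/2) ≤
32 exp v`. -/
lemma gaussKernelDeriv2_sq_div_le (hr : 0 < r) (z : ℝ) :
    gaussKernelDeriv2 r z ^ 2 / gaussKernel r z ≤
      32 / r ^ 4 * (Real.exp (z ^ 2 / (4 * r ^ 2)) * gaussKernel r z) := by
  have hp := gaussKernel_pos hr z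
  have h := Real.quadratic_le_exp_of_nonneg (x := z ^ 2 / (4 * r ^ 2)) (by positivity)
  have hv : 0 ≤ z ^ 2 / (4 * r ^ 2) := by positivity
  have e : gaussKernelDeriv2 r z ^ 2 / gaussKernel r z =
      1 / r ^ 4 * (4 * (z ^ 2 / (4 * r ^ 2)) - 1) ^ 2 * gaussKernel r z := by
    rw [gaussKernelDeriv2]; field_simp
  rw [e, ← mul_assoc, show (32 / r ^ 4 : ℝ) = 1 / r ^ 4 * 32 by ring, mul_assoc (1 / r ^ 4) 32]
  gcongr
  nlinarith

lemma integrable_gaussKernelDeriv2_sq_div (hr : 0 < r) :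
    Integrable fun z => gaussKernelDeriv2 r z ^ 2 / gaussKernel r z := by
  have h1 := continuous_gaussKernel hr
  have h2 := continuous_gaussKernelDeriv2 hr
  refine ((integrable_exp_mul_gaussKernel hr).const_mul (32 / r ^ 4)).mono'
    ((h2.pow 2).div h1 fun z => (gaussKernel_pos hr z).ne').aestronglyMeasurable
    (Filter.Eventually.of_forall fun z => ?_)
  have := gaussKernel_pos hr z
  rw [Real.norm_of_nonneg (by positivity)]
  exact gaussKernelDeriv2_sq_div_le hr z

lemma integrable_smoothedDeriv2_sq_div (hr : 0 < r) :
    Integrable fun x => smoothedDeriv2 P r x ^ 2 / smoothedDensity P r x :=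
  integrable_sq_integral_translate_div hr (continuous_gaussKernelDeriv2 hr)
    (integrable_gaussKernelDeriv2_sq_div hr)

lemma integral_smoothedDeriv2_sq_div_le (hr : 0 < r) :
    ∫ x, smoothedDeriv2 P r x ^ 2 / smoothedDensity P r x ≤ 48 / r ^ 4 := by
  have h2 : √2 ≤ 3 / 2 := by rw [Real.sqrt_le_left (by norm_num)]; norm_num
  calc _ ≤ ∫ z, gaussKernelDeriv2 r z ^ 2 / gaussKernel r z :=
        integral_sq_integral_translate_div_le hr (continuous_gaussKernelDeriv2 hr)
          (integrable_gaussKernelDeriv2_sq_div hr)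
    _ ≤ ∫ z, 32 / r ^ 4 * (Real.exp (z ^ 2 / (4 * r ^ 2)) * gaussKernel r z) :=
        integral_mono (integrable_gaussKernelDeriv2_sq_div hr)
          ((integrable_exp_mul_gaussKernel hr).const_mul _) (gaussKernelDeriv2_sq_div_le hr)
    _ = 32 / r ^ 4 * √2 := by rw [integral_const_mul, integral_exp_mul_gaussKernel hr]
    _ ≤ 32 / r ^ 4 * (3 / 2) := by gcongr
    _ = _ := by ring

/-! ### Shifting the density -/

/-- The error of the first order expansion of a shifted Gaussian kernel. -/
noncomputable def kernelRemainder (r h z : ℝ) : ℝ :=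
  gaussKernel r z - gaussKernel r (z - h) - h * gaussKernelDeriv r z

/-- The error of the first order expansion of the shifted smoothed density. -/
noncomputable def densityRemainder (P : Measure ℝ) (r h x : ℝ) : ℝ :=
  ∫ y, kernelRemainder r h (x - y) ∂P

lemma continuous_kernelRemainder (hr : 0 < r) (h : ℝ) : Continuous (kernelRemainder r h) := by
  have h1 := continuous_gaussKernel hr
  have h2 := continuous_gaussKernelDeriv hr
  unfold kernelRemainder
  fun_prop

lemma density_sub_shift_eq (hr : 0 < r) (h x : ℝ) :
    smoothedDensity P r x - smoothedDensity P r (x - h) =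
      h * smoothedDeriv P r x + densityRemainder P r h x := by
  have h1 := integrable_gaussKernel_translate (P := P) hr x
  have h2 := integrable_gaussKernel_translate (P := P) hr (x - h)
  have h3 := (integrable_gaussKernelDeriv_translate (P := P) hr x).const_mul h
  have e : densityRemainder P r h x = smoothedDensity P r x - smoothedDensity P r (x - h)
      - h * smoothedDeriv P r x := by
    simp_rw [densityRemainder, kernelRemainder]
    have h2' : Integrable (fun y => gaussKernel r (x - y - h)) P := by
      refine h2.congr (Filter.Eventually.of_forall fun y => ?_)
      simp only; congr 1; ring
    have h12 : Integrable (fun y => gaussKernel r (x - y) - gaussKernel r (x - y - h)) P :=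
      h1.sub h2'
    rw [integral_sub h12 h3, integral_sub h1 h2', integral_const_mul]
    have : ∀ y, x - y - h = x - h - y := fun y => by ring
    simp_rw [this]
    rfl
  rw [e]; ring

lemma kernelRemainder_sq_div (hr : 0 < r) (h z : ℝ) :
    kernelRemainder r h z ^ 2 / gaussKernel r z =
      Real.exp (h ^ 2 / r ^ 2) * gaussKernel r (z - 2 * h)
      + (gaussKernel r z + 2 * h / r ^ 2 * (z * gaussKernel r z)
        + h ^ 2 / r ^ 4 * (z ^ 2 * gaussKernel r z))
      - (2 * (1 + h ^ 2 / r ^ 2) * gaussKernel r (z - h)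
        + 2 * h / r ^ 2 * ((z - h) * gaussKernel r (z - h))) := by
  rw [← gaussKernel_shift_sq_div hr, kernelRemainder, gaussKernelDeriv]
  have hp := gaussKernel_pos hr z
  field_simp
  ring

/-- Every term of the expanded square is a translate of `w`, `z w` or `z² w`, so the integral is
computed exactly. What is left is an exponential minus its first-order Taylor polynomial, hence of
order `h⁴ / r⁴` when `|h| ≤ r`. -/
lemma integral_kernelRemainder_sq_div (hr : 0 < r) (h : ℝ) :
    Integrable (fun z => kernelRemainder r h z ^ 2 / gaussKernel r z) ∧
    ∫ z, kernelRemainder r h z ^ 2 / gaussKernel r z =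
      Real.exp (h ^ 2 / r ^ 2) - 1 - h ^ 2 / r ^ 2 := by
  simp_rw [kernelRemainder_sq_div hr h]
  have i0 := integrable_gaussKernel (r := r)
  have i1 := integrable_mul_gaussKernel hr
  have i2 := integrable_sq_mul_gaussKernel hr
  have A := (i0.comp_sub_right (2 * h)).const_mul (Real.exp (h ^ 2 / r ^ 2))
  have B1 := i1.const_mul (2 * h / r ^ 2)
  have B2 := i2.const_mul (h ^ 2 / r ^ 4)
  have B : Integrable (fun z => gaussKernel r z + 2 * h / r ^ 2 * (z * gaussKernel r z)
        + h ^ 2 / r ^ 4 * (z ^ 2 * gaussKernel r z)) := (i0.add B1).add B2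
  have B01 : Integrable (fun z => gaussKernel r z + 2 * h / r ^ 2 * (z * gaussKernel r z)) :=
    i0.add B1
  have C0 := (i0.comp_sub_right h).const_mul (2 * (1 + h ^ 2 / r ^ 2))
  have C1 := (i1.comp_sub_right h).const_mul (2 * h / r ^ 2)
  have C : Integrable (fun z => 2 * (1 + h ^ 2 / r ^ 2) * gaussKernel r (z - h)
        + 2 * h / r ^ 2 * ((z - h) * gaussKernel r (z - h))) := C0.add C1
  have AB : Integrable (fun z => Real.exp (h ^ 2 / r ^ 2) * gaussKernel r (z - 2 * h)
      + (gaussKernel r z + 2 * h / r ^ 2 * (z * gaussKernel r z)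
        + h ^ 2 / r ^ 4 * (z ^ 2 * gaussKernel r z))) := A.add B
  refine ⟨AB.sub C, ?_⟩
  rw [integral_sub AB C, integral_add A B, integral_add B01 B2, integral_add i0 B1,
    integral_add C0 C1]
  simp only [integral_const_mul]
  rw [integral_sub_right_eq_self (gaussKernel r) (2 * h),
    integral_sub_right_eq_self (gaussKernel r) h,
    integral_sub_right_eq_self (fun z => z * gaussKernel r z) h, integral_gaussKernel hr,
    integral_mul_gaussKernel hr, integral_sq_mul_gaussKernel hr]
  field_simp
  ring

lemma continuous_densityRemainder (hr : 0 < r) (h : ℝ) :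
    Continuous (densityRemainder P r h) := by
  have h1 := continuous_smoothedDensity (P := P) hr
  have h2 := continuous_smoothedDeriv (P := P) hr
  have : densityRemainder P r h = fun x => smoothedDensity P r x - smoothedDensity P r (x - h)
      - h * smoothedDeriv P r x := by
    ext x; rw [density_sub_shift_eq hr]; ring
  rw [this]; fun_prop

lemma integrable_densityRemainder_sq_div (hr : 0 < r) (h : ℝ) :
    Integrable fun x => densityRemainder P r h x ^ 2 / smoothedDensity P r x :=
  integrable_sq_integral_translate_div hr (continuous_kernelRemainder hr h)
    (integral_kernelRemainder_sq_div hr h).1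

lemma integral_densityRemainder_sq_div_le (hr : 0 < r) {h : ℝ} (hh : |h| ≤ r) :
    ∫ x, densityRemainder P r h x ^ 2 / smoothedDensity P r x ≤ h ^ 4 / r ^ 4 := by
  have h0 := integral_sq_integral_translate_div_le (P := P) hr (continuous_kernelRemainder hr h)
    (integral_kernelRemainder_sq_div hr h).1
  rw [(integral_kernelRemainder_sq_div hr h).2] at h0
  refine h0.trans ?_
  have h1 : |h ^ 2 / r ^ 2| ≤ 1 := by
    rw [abs_of_nonneg (by positivity), div_le_one (by positivity)]
    exact sq_le_sq.2 (hh.trans (le_abs_self r))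
  have := le_of_abs_le (Real.abs_exp_sub_one_sub_id_le h1)
  refine this.trans (le_of_eq ?_)
  field_simp

end Moments

/-! ### Cauchy–Schwarz with weight `f_r`, obtained by splitting `f_r = √f_r · √f_r`. -/

section Weighted

variable {P : Measure ℝ} [IsProbabilityMeasure P] {r : ℝ} {a b : ℝ → ℝ}

lemma sq_mul_sqrt_density (hr : 0 < r) (a : ℝ → ℝ) :
    (fun x => (a x * √(smoothedDensity P r x)) ^ 2) = fun x => a x ^ 2 * smoothedDensity P r x := by
  ext x
  rw [mul_pow, Real.sq_sqrt (smoothedDensity_pos hr x).le]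

lemma mul_sqrt_density (hr : 0 < r) (a b : ℝ → ℝ) :
    (fun x => a x * √(smoothedDensity P r x) * (b x * √(smoothedDensity P r x))) =
      fun x => a x * b x * smoothedDensity P r x := by
  ext x
  have := Real.mul_self_sqrt (smoothedDensity_pos (P := P) hr x).le
  linear_combination a x * b x * this

lemma integrable_mul_mul_density (hr : 0 < r) (ha : Measurable a) (hb : Measurable b)
    (ha2 : Integrable fun x => a x ^ 2 * smoothedDensity P r x)
    (hb2 : Integrable fun x => b x ^ 2 * smoothedDensity P r x) :
    Integrable fun x => a x * b x * smoothedDensity P r x := by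
  have hc := (continuous_smoothedDensity (P := P) hr).measurable
  rw [← mul_sqrt_density hr]
  exact integrable_mul_of_sq (u := fun x => a x * √(smoothedDensity P r x))
    (v := fun x => b x * √(smoothedDensity P r x)) (ha.mul hc.sqrt).aestronglyMeasurable
    (hb.mul hc.sqrt).aestronglyMeasurable (by rwa [sq_mul_sqrt_density hr])
    (by rwa [sq_mul_sqrt_density hr])

/-- The Cauchy–Schwarz inequality in `L²(f_r)`. -/
lemma integral_abs_mul_density_le (hr : 0 < r) (ha : Measurable a) (hb : Measurable b)
    (ha2 : Integrable fun x => a x ^ 2 * smoothedDensity P r x)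
    (hb2 : Integrable fun x => b x ^ 2 * smoothedDensity P r x) :
    ∫ x, |a x * b x * smoothedDensity P r x| ≤
      √(∫ x, a x ^ 2 * smoothedDensity P r x) * √(∫ x, b x ^ 2 * smoothedDensity P r x) := by
  have hc := (continuous_smoothedDensity (P := P) hr).measurable
  have e : ∀ a : ℝ → ℝ, (fun x => (|a x| * √(smoothedDensity P r x)) ^ 2) =
      fun x => a x ^ 2 * smoothedDensity P r x := fun a => by
    rw [sq_mul_sqrt_density hr fun x => |a x|]; simp_rw [sq_abs]
  have h := abs_integral_mul_le_sqrt (ν := volume)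
    (u := fun x => |a x| * √(smoothedDensity P r x))
    (v := fun x => |b x| * √(smoothedDensity P r x))
    ((continuous_abs.measurable.comp ha).mul hc.sqrt).aestronglyMeasurable
    ((continuous_abs.measurable.comp hb).mul hc.sqrt).aestronglyMeasurable
    (by rwa [e]) (by rwa [e])
  rw [mul_sqrt_density hr (fun x => |a x|) (fun x => |b x|), e, e] at h
  refine le_trans (le_of_eq ?_) ((le_abs_self _).trans h)
  congr 1; ext x
  rw [abs_mul, abs_mul, abs_of_pos (smoothedDensity_pos hr x)]

lemma abs_setIntegral_mul_density_le (hr : 0 < r) (ha : Measurable a) (hb : Measurable b)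
    (ha2 : Integrable fun x => a x ^ 2 * smoothedDensity P r x)
    (hb2 : Integrable fun x => b x ^ 2 * smoothedDensity P r x) (A : Set ℝ) :
    |∫ x in A, a x * b x * smoothedDensity P r x| ≤
      √(∫ x, a x ^ 2 * smoothedDensity P r x) * √(∫ x, b x ^ 2 * smoothedDensity P r x) :=
  abs_integral_le_integral_abs.trans
    ((setIntegral_le_integral (integrable_mul_mul_density hr ha hb ha2 hb2).abs
      (Filter.Eventually.of_forall fun _ => abs_nonneg _)).trans
      (integral_abs_mul_density_le hr ha hb ha2 hb2))

end Weighted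

/-! ### Second moment of the smoothed law and the lower bound on Fisher information. -/

section SecondMoment

variable {P : Measure ℝ} {r μ σ : ℝ}

lemma integral_centered_sq (hmean : ∫ x, x ∂P = μ)
    (hvar : variance (fun x : ℝ => x) P = σ ^ 2) : ∫ y, (y - μ) ^ 2 ∂P = σ ^ 2 := by
  rw [variance_eq_integral (by fun_prop), hmean] at hvar
  exact hvar

variable [IsProbabilityMeasure P]

lemma integrable_centered (hP : MemLp (fun x : ℝ => x) 2 P) : Integrable (fun y => y - μ) P :=
  (hP.integrable (by norm_num)).sub (integrable_const μ)

lemma integrable_centered_sq (hP : MemLp (fun x : ℝ => x) 2 P) :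
    Integrable (fun y => (y - μ) ^ 2) P :=
  (hP.sub (memLp_const μ)).integrable_sq

lemma ae_centered_sq_mul_density_le (hr : 0 < r) (hP : MemLp (fun x : ℝ => x) 2 P) :
    ∀ᵐ x, (x - μ) ^ 2 * smoothedDensity P r x ≤
      2 * (∫ y, (x - y) ^ 2 * gaussKernel r (x - y) ∂P) +
        2 * ∫ y, (y - μ) ^ 2 * gaussKernel r (x - y) ∂P := by
  filter_upwards [ae_integrable_translate_one (P := P) (integrable_sq_mul_gaussKernel hr),
    ae_integrable_translate (integrable_centered_sq (μ := μ) hP)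
      (integrable_gaussKernel (r := r))] with x h1 h2
  rw [← integral_const_mul, ← integral_const_mul, ← integral_add (h1.const_mul 2) (h2.const_mul 2),
    smoothedDensity, ← integral_const_mul]
  refine integral_mono ((integrable_gaussKernel_translate hr x).const_mul _)
    ((h1.const_mul 2).add (h2.const_mul 2)) fun y => ?_
  have := gaussKernel_pos hr (x - y)
  simp only
  have h : (x - μ) ^ 2 ≤ 2 * (x - y) ^ 2 + 2 * (y - μ) ^ 2 := by
    nlinarith [sq_nonneg ((x - y) - (y - μ))]
  nlinarith

lemma integrable_second_moment_bound (hr : 0 < r) (hP : MemLp (fun x : ℝ => x) 2 P) :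
    Integrable fun x => 2 * (∫ y, (x - y) ^ 2 * gaussKernel r (x - y) ∂P) +
        2 * ∫ y, (y - μ) ^ 2 * gaussKernel r (x - y) ∂P :=
  ((integrable_translate_one (P := P) (integrable_sq_mul_gaussKernel hr)).const_mul 2).add
    ((integrable_translate (integrable_centered_sq (μ := μ) hP)
      (integrable_gaussKernel (r := r))).const_mul 2)

lemma integrable_centered_sq_mul_density (hr : 0 < r) (hP : MemLp (fun x : ℝ => x) 2 P) :
    Integrable fun x => (x - μ) ^ 2 * smoothedDensity P r x := by
  have h1 := continuous_smoothedDensity (P := P) hr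
  refine (integrable_second_moment_bound (μ := μ) hr hP).mono' (by fun_prop) ?_
  filter_upwards [ae_centered_sq_mul_density_le (μ := μ) hr hP] with x hx
  have := smoothedDensity_pos (P := P) hr x
  rwa [Real.norm_of_nonneg (by positivity)]

/-- The true value is `σ² + r²`. The cruder bound comes from `(a + b)² ≤ 2a² + 2b²` for `x - μ = (x
- y) + (y - μ)`, together with `r ≤ σ`. -/
lemma integral_centered_sq_mul_density_le (hr : 0 < r) (hrσ : r ≤ σ)
    (hP : MemLp (fun x : ℝ => x) 2 P) (hmean : ∫ x, x ∂P = μ)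
    (hvar : variance (fun x : ℝ => x) P = σ ^ 2) :
    ∫ x, (x - μ) ^ 2 * smoothedDensity P r x ≤ 4 * σ ^ 2 := by
  have h := integral_mono_ae (integrable_centered_sq_mul_density (μ := μ) hr hP)
    (integrable_second_moment_bound (μ := μ) hr hP) (ae_centered_sq_mul_density_le hr hP)
  rw [integral_add
    ((integrable_translate_one (P := P) (integrable_sq_mul_gaussKernel hr)).const_mul 2)
    ((integrable_translate (integrable_centered_sq (μ := μ) hP)
      (integrable_gaussKernel (r := r))).const_mul 2), integral_const_mul, integral_const_mul,
    integral_translate_one (integrable_sq_mul_gaussKernel hr),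
    integral_translate (integrable_centered_sq hP) integrable_gaussKernel,
    integral_sq_mul_gaussKernel hr, integral_gaussKernel hr,
    integral_centered_sq hmean hvar] at h
  have : r ^ 2 ≤ σ ^ 2 := by gcongr
  linarith

/-- Integration by parts, carried out on the kernel: split `x - μ = (x - y) + (y - μ)`. The first
part integrates to `-1`, and the second vanishes because `P` has mean `μ`. -/
lemma integral_centered_mul_deriv (hr : 0 < r) (hP : MemLp (fun x : ℝ => x) 2 P)
    (hmean : ∫ x, x ∂P = μ) : ∫ x, (x - μ) * smoothedDeriv P r x = -1 := by
  have k1 : Integrable fun z => z * gaussKernelDeriv r z :=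
    ((integrable_sq_mul_gaussKernel hr).const_mul (-(1 / r ^ 2))).congr
      (Filter.Eventually.of_forall fun z => by simp only [gaussKernelDeriv]; ring)
  have k2 : Integrable (gaussKernelDeriv r) :=
    ((integrable_mul_gaussKernel hr).const_mul (-(1 / r ^ 2))).congr
      (Filter.Eventually.of_forall fun z => by simp only [gaussKernelDeriv]; ring)
  have v1 : ∫ z, z * gaussKernelDeriv r z = -1 := by
    have : ∀ z, z * gaussKernelDeriv r z = -(1 / r ^ 2) * (z ^ 2 * gaussKernel r z) := fun z => by
      rw [gaussKernelDeriv]; ring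
    simp_rw [this]
    rw [integral_const_mul, integral_sq_mul_gaussKernel hr]
    field_simp
  have v2 : ∫ y, (y - μ) ∂P = 0 := by
    rw [integral_sub (hP.integrable (by norm_num)) (integrable_const μ), hmean]; simp
  have e : ∀ᵐ x, (x - μ) * smoothedDeriv P r x = (∫ y, (x - y) * gaussKernelDeriv r (x - y) ∂P)
      + ∫ y, (y - μ) * gaussKernelDeriv r (x - y) ∂P := by
    filter_upwards [ae_integrable_translate_one (P := P) k1,
      ae_integrable_translate (integrable_centered (μ := μ) hP) k2] with x h1 h2
    rw [← integral_add h1 h2, smoothedDeriv, ← integral_const_mul]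
    congr 1; ext y; ring
  rw [integral_congr_ae e, integral_add (integrable_translate_one k1)
    (integrable_translate (integrable_centered hP) k2), integral_translate_one k1,
    integral_translate (integrable_centered hP) k2, v1, v2]
  ring

/-- A lower bound of Cramér–Rao type for the Fisher information. -/
lemma one_le_mul_smoothedFisherInfo (hr : 0 < r) (hrσ : r ≤ σ)
    (hP : MemLp (fun x : ℝ => x) 2 P) (hmean : ∫ x, x ∂P = μ)
    (hvar : variance (fun x : ℝ => x) P = σ ^ 2) :
    1 ≤ 4 * σ ^ 2 * smoothedFisherInfo P r := by
  have h := abs_setIntegral_mul_density_le hr (a := fun x => x - μ) (b := smoothedScore P r)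
    (by fun_prop) (continuous_smoothedScore hr).measurable
    (integrable_centered_sq_mul_density (P := P) hr hP) (integrable_score_sq hr) Set.univ
  rw [← smoothedFisherInfo_eq hr] at h
  simp_rw [mul_assoc, smoothedScore_mul hr] at h
  rw [setIntegral_univ, integral_centered_mul_deriv hr hP hmean, abs_neg, abs_one] at h
  have hI : 0 ≤ smoothedFisherInfo P r := by
    rw [smoothedFisherInfo]; exact integral_nonneg fun x => sq_nonneg _
  rw [← Real.sqrt_mul (integral_nonneg fun x =>
    mul_nonneg (sq_nonneg _) (smoothedDensity_pos hr x).le), Real.one_le_sqrt] at h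
  refine h.trans ?_
  gcongr
  exact integral_centered_sq_mul_density_le hr hrσ hP hmean hvar

end SecondMoment

/-! ### Reflection symmetry and a uniform bound on `s² f_r`. -/

section Center

variable {P : Measure ℝ} {r μ : ℝ}

lemma smoothedFisherInfo_nonneg : 0 ≤ smoothedFisherInfo P r :=
  integral_nonneg fun _ => sq_nonneg _

lemma smoothedDensity_reflect (hr : 0 < r) (hsym : P.map (fun x : ℝ => 2 * μ - x) = P) (x : ℝ) :
    smoothedDensity P r (2 * μ - x) = smoothedDensity P r x := by
  have hc := continuous_gaussKernel hr
  conv_lhs => rw [smoothedDensity, ← hsym]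
  rw [integral_map (by fun_prop) (by fun_prop), smoothedDensity]
  congr 1; ext y
  rw [gaussKernel_eq hr, gaussKernel_eq hr]
  ring_nf

variable [IsProbabilityMeasure P]

lemma smoothedDeriv_reflect (hr : 0 < r) (hsym : P.map (fun x : ℝ => 2 * μ - x) = P) (x : ℝ) :
    smoothedDeriv P r (2 * μ - x) = -smoothedDeriv P r x := by
  have h1 := (hasDerivAt_smoothedDensity (P := P) hr (2 * μ - x)).comp_const_sub (2 * μ) x
  have h2 : (fun x => smoothedDensity P r (2 * μ - x)) = smoothedDensity P r :=
    funext (smoothedDensity_reflect hr hsym)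
  rw [h2] at h1
  have := h1.unique (hasDerivAt_smoothedDensity hr x)
  linarith

lemma smoothedScore_reflect (hr : 0 < r) (hsym : P.map (fun x : ℝ => 2 * μ - x) = P) (x : ℝ) :
    smoothedScore P r (2 * μ - x) = -smoothedScore P r x := by
  rw [smoothedScore_eq hr, smoothedScore_eq hr, smoothedDeriv_reflect hr hsym,
    smoothedDensity_reflect hr hsym, neg_div]

lemma smoothedScore_center (hr : 0 < r) (hsym : P.map (fun x : ℝ => 2 * μ - x) = P) :
    smoothedScore P r μ = 0 := by
  have := smoothedScore_reflect hr hsym μ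
  rw [show 2 * μ - μ = μ by ring] at this
  linarith

/-- One of the two terms in the derivative `2 s f'' - s³ f` of `s² f`. Cauchy–Schwarz pairs `s √f`
with `f'' / √f`, so that a factor `√I` survives; the constant uses `48 ≤ 7²`. -/
lemma integrable_score_mul_deriv2 (hr : 0 < r) :
    Integrable (fun x => smoothedScore P r x * smoothedDeriv2 P r x) ∧
    ∫ x, |smoothedScore P r x * smoothedDeriv2 P r x| ≤ √(smoothedFisherInfo P r) * (7 / r ^ 2) := by
  have e1 : ∀ x, (smoothedDeriv2 P r x / smoothedDensity P r x) ^ 2 * smoothedDensity P r x =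
      smoothedDeriv2 P r x ^ 2 / smoothedDensity P r x := fun x => by
    have := (smoothedDensity_pos (P := P) hr x).ne'; field_simp
  have e2 : ∀ x, smoothedScore P r x * (smoothedDeriv2 P r x / smoothedDensity P r x) *
      smoothedDensity P r x = smoothedScore P r x * smoothedDeriv2 P r x := fun x => by
    have := (smoothedDensity_pos (P := P) hr x).ne'; field_simp
  have ms := (continuous_smoothedScore (P := P) hr).measurable
  have md : Measurable fun x => smoothedDeriv2 P r x / smoothedDensity P r x :=
    (continuous_smoothedDeriv2 hr).measurable.div (continuous_smoothedDensity hr).measurable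
  have i2 := integrable_smoothedDeriv2_sq_div (P := P) hr
  simp_rw [← e1] at i2
  have h1 := integrable_mul_mul_density hr ms md (integrable_score_sq hr) i2
  have h2 := integral_abs_mul_density_le hr ms md (integrable_score_sq hr) i2
  simp_rw [e2] at h1 h2
  simp_rw [e1] at h2
  rw [← smoothedFisherInfo_eq hr] at h2
  refine ⟨h1, h2.trans ?_⟩
  gcongr
  apply Real.sqrt_le_iff.2 ⟨by positivity, (integral_smoothedDeriv2_sq_div_le hr).trans ?_⟩
  rw [div_pow, ← pow_mul]; gcongr; norm_num

lemma integrable_score_cube (hr : 0 < r) :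
    Integrable (fun x => smoothedScore P r x ^ 3 * smoothedDensity P r x) ∧
    ∫ x, |smoothedScore P r x ^ 3 * smoothedDensity P r x| ≤
      √(smoothedFisherInfo P r) * (7 / r ^ 2) := by
  have ms := (continuous_smoothedScore (P := P) hr).measurable
  have i4 := integrable_score_fourth (P := P) hr
  have e1 : ∀ x, (smoothedScore P r x ^ 2) ^ 2 = smoothedScore P r x ^ 4 := fun x => by ring
  have e2 : ∀ x, smoothedScore P r x * smoothedScore P r x ^ 2 = smoothedScore P r x ^ 3 :=
    fun x => by ring
  simp_rw [← e1] at i4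
  have h1 := integrable_mul_mul_density hr ms (ms.pow_const 2) (integrable_score_sq hr) i4
  have h2 := integral_abs_mul_density_le hr ms (ms.pow_const 2) (integrable_score_sq hr) i4
  simp_rw [e2] at h1 h2
  simp_rw [e1] at h2
  rw [← smoothedFisherInfo_eq hr] at h2
  refine ⟨h1, h2.trans ?_⟩
  gcongr
  apply Real.sqrt_le_iff.2 ⟨by positivity, (integral_score_fourth_le hr).trans ?_⟩
  rw [div_pow, ← pow_mul]; gcongr; norm_num

/-- Integrating the derivative of `s² f` from the centre of symmetry bounds `s² f` uniformly. -/
lemma score_sq_mul_density_le (hr : 0 < r) (hsym : P.map (fun x : ℝ => 2 * μ - x) = P) (x : ℝ) :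
    smoothedScore P r x ^ 2 * smoothedDensity P r x ≤
      21 * √(smoothedFisherInfo P r) / r ^ 2 := by
  obtain ⟨i1, b1⟩ := integrable_score_mul_deriv2 (P := P) hr
  obtain ⟨i2, b2⟩ := integrable_score_cube (P := P) hr
  have hi : Integrable fun x => 2 * (smoothedScore P r x * smoothedDeriv2 P r x)
      - smoothedScore P r x ^ 3 * smoothedDensity P r x := (i1.const_mul 2).sub i2
  have hd : ∀ x, HasDerivAt (fun x => smoothedScore P r x ^ 2 * smoothedDensity P r x)
      (2 * (smoothedScore P r x * smoothedDeriv2 P r x)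
        - smoothedScore P r x ^ 3 * smoothedDensity P r x) x := fun x => by
    have hf := (smoothedDensity_pos (P := P) hr x).ne'
    have h1 : (fun x => smoothedScore P r x ^ 2 * smoothedDensity P r x) =
        fun x => smoothedDeriv P r x ^ 2 / smoothedDensity P r x := by
      ext x; have := (smoothedDensity_pos (P := P) hr x).ne'
      rw [smoothedScore_eq hr]; field_simp
    rw [h1]
    refine (((hasDerivAt_smoothedDeriv hr x).pow 2).div (hasDerivAt_smoothedDensity hr x)
      hf).congr_deriv ?_
    rw [smoothedScore_eq hr]
    simp only [Pi.pow_apply]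
    field_simp
    push_cast
    ring
  have h := intervalIntegral.integral_eq_sub_of_hasDerivAt (a := μ) (b := x)
    (fun x _ => hd x) hi.intervalIntegrable
  -- The score is odd about `μ`, so the boundary term at `μ` vanishes.
  rw [smoothedScore_center hr hsym] at h
  have h3 := intervalIntegral.norm_integral_le_integral_norm_uIoc (a := μ) (b := x)
    (μ := volume) (f := fun x => 2 * (smoothedScore P r x * smoothedDeriv2 P r x)
      - smoothedScore P r x ^ 3 * smoothedDensity P r x)
  rw [h] at h3
  have h4 := h3.trans (setIntegral_le_integral hi.norm
    (Filter.Eventually.of_forall fun _ => norm_nonneg _))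
  have h5 : ∫ x, ‖2 * (smoothedScore P r x * smoothedDeriv2 P r x)
      - smoothedScore P r x ^ 3 * smoothedDensity P r x‖ ≤
      ∫ x, (2 * |smoothedScore P r x * smoothedDeriv2 P r x|
        + |smoothedScore P r x ^ 3 * smoothedDensity P r x|) := by
    refine integral_mono hi.norm ((i1.abs.const_mul 2).add i2.abs) fun x => ?_
    refine (norm_sub_le _ _).trans (le_of_eq ?_)
    simp [abs_mul]
  rw [integral_add (i1.abs.const_mul 2) i2.abs, integral_const_mul] at h5
  have h6 := (le_abs_self _).trans (h4.trans h5)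
  rw [zero_pow two_ne_zero, zero_mul, sub_zero] at h6
  calc _ ≤ _ := h6
    _ ≤ 2 * (√(smoothedFisherInfo P r) * (7 / r ^ 2)) + √(smoothedFisherInfo P r) * (7 / r ^ 2) := by
        gcongr
    _ = _ := by ring

end Center

/-! ### Reduction of the symmetrized mean to the `L²(f_r)` error of the score estimate. -/

section Symmetrization

variable {P : Measure ℝ} [IsProbabilityMeasure P] {r μ : ℝ} {ψ : ℝ → ℝ} {B : ℝ}

/-- Substituting `x ↦ 2(μ + ε) - x` below the symmetrization point turns the density there into
`f(2μ - (x - 2ε)) = f(x - 2ε)`, by symmetry about `μ`. -/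
lemma integral_symmetrized (hr : 0 < r) (hsym : P.map (fun x : ℝ => 2 * μ - x) = P)
    (hψ : Measurable ψ) (hB : ∀ x, |ψ x| ≤ B) (ε : ℝ) :
    ∫ x, (if μ + ε ≤ x then ψ x else -ψ (2 * (μ + ε) - x)) ∂(smoothedLaw P r) =
      ∫ x in Set.Ici (μ + ε),
        ψ x * (smoothedDensity P r x - smoothedDensity P r (x - 2 * ε)) := by
  set y := μ + ε with hy
  have hif := integrable_smoothedDensity (P := P) (r := r)
  have i1 : Integrable fun x => ψ x * smoothedDensity P r x :=
    hif.bdd_mul hψ.aestronglyMeasurable (Filter.Eventually.of_forall hB)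
  have i2 : Integrable fun x => ψ x * smoothedDensity P r (x - 2 * ε) :=
    (hif.comp_sub_right (2 * ε)).bdd_mul hψ.aestronglyMeasurable (Filter.Eventually.of_forall hB)
  -- The half-line is open because the reflected region is `x < y`; the endpoint is restored later
  -- as a null set.
  set F := (Set.Ioi y).indicator fun x => ψ x * smoothedDensity P r (x - 2 * ε) with hF
  have iF : Integrable F := i2.indicator measurableSet_Ioi
  rw [integral_smoothedLaw hr]
  have e : (fun x => (if y ≤ x then ψ x else -ψ (2 * y - x)) * smoothedDensity P r x) =
      fun x => (Set.Ici y).indicator (fun x => ψ x * smoothedDensity P r x) x - F (2 * y - x) := by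
    ext x
    rw [hF]
    by_cases hx : y ≤ x
    · rw [if_pos hx, Set.indicator_of_mem (Set.mem_Ici.2 hx), Set.indicator_of_notMem, sub_zero]
      rw [Set.mem_Ioi]; linarith
    · rw [if_neg hx, Set.indicator_of_notMem (by simpa using hx), Set.indicator_of_mem]
      · rw [show 2 * y - x - 2 * ε = 2 * μ - x by rw [hy]; ring, smoothedDensity_reflect hr hsym]
        ring
      · rw [Set.mem_Ioi]; linarith
  rw [e, integral_sub (i1.indicator measurableSet_Ici) (iF.comp_sub_left (2 * y)),
    integral_sub_left_eq_self F volume (2 * y), hF, integral_indicator measurableSet_Ici,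
    integral_indicator measurableSet_Ioi, ← integral_Ici_eq_integral_Ioi,
    ← integral_sub i1.integrableOn i2.integrableOn]
  congr 1; ext x; ring

lemma setIntegral_Ici_score_sq (hr : 0 < r) (hsym : P.map (fun x : ℝ => 2 * μ - x) = P) :
    ∫ x in Set.Ici μ, smoothedScore P r x ^ 2 * smoothedDensity P r x =
      smoothedFisherInfo P r / 2 := by
  have hi := integrable_score_sq (P := P) hr
  set G := (Set.Ioi μ).indicator fun x => smoothedScore P r x ^ 2 * smoothedDensity P r x with hG
  have e : (fun x => smoothedScore P r x ^ 2 * smoothedDensity P r x) =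
      fun x => (Set.Ici μ).indicator
        (fun x => smoothedScore P r x ^ 2 * smoothedDensity P r x) x + G (2 * μ - x) := by
    ext x
    rw [hG]
    by_cases hx : μ ≤ x
    · rw [Set.indicator_of_mem (Set.mem_Ici.2 hx), Set.indicator_of_notMem, add_zero]
      rw [Set.mem_Ioi]; linarith
    · rw [Set.indicator_of_notMem (by simpa using hx), Set.indicator_of_mem,
        smoothedDensity_reflect hr hsym, smoothedScore_reflect hr hsym]
      · ring
      · rw [Set.mem_Ioi]; linarith
  have h : smoothedFisherInfo P r =
      ∫ x, (Set.Ici μ).indicator (fun x => smoothedScore P r x ^ 2 * smoothedDensity P r x) x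
        + G (2 * μ - x) :=
    (smoothedFisherInfo_eq hr).trans (congrArg (fun u => ∫ x, u x) e)
  rw [integral_add (hi.indicator measurableSet_Ici)
    ((hi.indicator measurableSet_Ioi).comp_sub_left (2 * μ)),
    integral_sub_left_eq_self G volume (2 * μ), hG, integral_indicator measurableSet_Ici,
    integral_indicator measurableSet_Ioi, ← integral_Ici_eq_integral_Ioi] at h
  linarith

/-- By symmetry the half-line from `μ` carries exactly half of the Fisher information; moving its
endpoint by `ε` costs `|ε|` times the supremum of `s² f`. -/
lemma abs_setIntegral_score_sq_sub_le (hr : 0 < r)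
    (hsym : P.map (fun x : ℝ => 2 * μ - x) = P) (ε : ℝ) :
    |(∫ x in Set.Ici (μ + ε), smoothedScore P r x ^ 2 * smoothedDensity P r x)
      - smoothedFisherInfo P r / 2| ≤ |ε| * (21 * √(smoothedFisherInfo P r) / r ^ 2) := by
  have hi := integrable_score_sq (P := P) hr
  have e : (∫ x in Set.Ici (μ + ε), smoothedScore P r x ^ 2 * smoothedDensity P r x)
      - smoothedFisherInfo P r / 2 =
      -∫ x in μ..(μ + ε), smoothedScore P r x ^ 2 * smoothedDensity P r x := by
    rw [← setIntegral_Ici_score_sq hr hsym,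
      ← intervalIntegral.integral_Iic_sub_Iic hi.integrableOn hi.integrableOn]
    have h1 := intervalIntegral.integral_Iic_add_Ioi (b := μ + ε) hi.integrableOn hi.integrableOn
    have h2 := intervalIntegral.integral_Iic_add_Ioi (b := μ) hi.integrableOn hi.integrableOn
    rw [integral_Ici_eq_integral_Ioi, integral_Ici_eq_integral_Ioi]
    linarith
  rw [e, abs_neg]
  have := intervalIntegral.norm_integral_le_of_norm_le_const (a := μ) (b := μ + ε)
    (f := fun x => smoothedScore P r x ^ 2 * smoothedDensity P r x)
    (C := 21 * √(smoothedFisherInfo P r) / r ^ 2) fun x _ => by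
      have := smoothedDensity_pos (P := P) hr x
      rw [Real.norm_of_nonneg (by positivity)]
      exact score_sq_mul_density_le hr hsym x
  rw [Real.norm_eq_abs, add_sub_cancel_left] at this
  linarith

/-- The mean of a symmetrized score estimate is controlled by its distance to the score in
`L²(f_r)`. -/
theorem abs_integral_symmetrized_sub_le (hr : 0 < r) (hsym : P.map (fun x : ℝ => 2 * μ - x) = P)
    (hψ : Measurable ψ) (hB : ∀ x, |ψ x| ≤ B) {ε : ℝ} (hε : |2 * ε| ≤ r) :
    |∫ x, (if μ + ε ≤ x then ψ x else -ψ (2 * (μ + ε) - x)) ∂(smoothedLaw P r)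
        - ε * smoothedFisherInfo P r| ≤
      √(∫ x, (ψ x - smoothedScore P r x) ^ 2 * smoothedDensity P r x) *
          √(8 * ε ^ 2 * smoothedFisherInfo P r + 32 * (ε ^ 4 / r ^ 4))
        + 46 * (ε ^ 2 / r ^ 2) * √(smoothedFisherInfo P r) := by
  set I := smoothedFisherInfo P r with hI
  set h := 2 * ε with hh
  have ms := (continuous_smoothedScore (P := P) hr).measurable
  have cf := continuous_smoothedDensity (P := P) hr
  have cR := continuous_densityRemainder (P := P) hr h
  have hif := integrable_smoothedDensity (P := P) (r := r)
  have hfp := smoothedDensity_pos (P := P) hr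
  have is2 := integrable_score_sq (P := P) hr
  have iR := integrable_densityRemainder_sq_div (P := P) hr h
  have bR := integral_densityRemainder_sq_div_le (P := P) hr hε
  have mρ : Measurable fun x => densityRemainder P r h x / smoothedDensity P r x :=
    cR.measurable.div cf.measurable
  have eρ : ∀ x, (densityRemainder P r h x / smoothedDensity P r x) ^ 2 * smoothedDensity P r x =
      densityRemainder P r h x ^ 2 / smoothedDensity P r x := fun x => by
    have := (hfp x).ne'; field_simp
  have iρ : Integrable fun x =>
      (densityRemainder P r h x / smoothedDensity P r x) ^ 2 * smoothedDensity P r x := by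
    simpa only [eρ] using iR
  -- The relative change of density under the shift `h = 2ε`: a score term plus the normalized
  -- Taylor remainder.
  set Δ : ℝ → ℝ := fun x => h * smoothedScore P r x + densityRemainder P r h x /
    smoothedDensity P r x with hΔ
  have mΔ : Measurable Δ := (ms.const_mul h).add mρ
  have eΔ : ∀ x, smoothedDensity P r x - smoothedDensity P r (x - h) =
      Δ x * smoothedDensity P r x := fun x => by
    rw [density_sub_shift_eq hr, ← smoothedScore_mul hr, hΔ]
    have := (hfp x).ne'; field_simp
  have bΔ : ∀ x, Δ x ^ 2 * smoothedDensity P r x ≤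
      2 * h ^ 2 * (smoothedScore P r x ^ 2 * smoothedDensity P r x) +
      2 * ((densityRemainder P r h x / smoothedDensity P r x) ^ 2 * smoothedDensity P r x) :=
    fun x => by
      have h1 : Δ x ^ 2 ≤ 2 * h ^ 2 * smoothedScore P r x ^ 2 +
          2 * (densityRemainder P r h x / smoothedDensity P r x) ^ 2 := by
        simp only [hΔ]
        nlinarith [sq_nonneg (h * smoothedScore P r x -
          densityRemainder P r h x / smoothedDensity P r x)]
      nlinarith [hfp x]
  have iΔ : Integrable fun x => Δ x ^ 2 * smoothedDensity P r x := by
    refine ((is2.const_mul (2 * h ^ 2)).add (iρ.const_mul 2)).mono'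
      ((mΔ.pow_const 2).mul cf.measurable).aestronglyMeasurable
      (Filter.Eventually.of_forall fun x => ?_)
    have := hfp x
    rw [Real.norm_of_nonneg (by positivity)]
    exact bΔ x
  have vΔ : ∫ x, Δ x ^ 2 * smoothedDensity P r x ≤ 8 * ε ^ 2 * I + 32 * (ε ^ 4 / r ^ 4) := by
    have := integral_mono iΔ ((is2.const_mul (2 * h ^ 2)).add (iρ.const_mul 2)) bΔ
    simp only [Pi.add_apply] at this
    rw [integral_add (is2.const_mul (2 * h ^ 2)) (iρ.const_mul 2), integral_const_mul,
      integral_const_mul, ← smoothedFisherInfo_eq hr] at this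
    simp_rw [eρ] at this
    calc _ ≤ _ := this
      _ ≤ 2 * h ^ 2 * I + 2 * (h ^ 4 / r ^ 4) := by gcongr
      _ = _ := by rw [hh]; ring
  have mD : Measurable fun x => ψ x - smoothedScore P r x := hψ.sub ms
  have iψ2 : Integrable fun x => ψ x ^ 2 * smoothedDensity P r x :=
    hif.bdd_mul (c := B ^ 2) (hψ.pow_const 2).aestronglyMeasurable
      (Filter.Eventually.of_forall fun x => by
        rw [Real.norm_of_nonneg (sq_nonneg _), ← sq_abs]
        exact pow_le_pow_left₀ (abs_nonneg _) (hB x) 2)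
  have iD : Integrable fun x => (ψ x - smoothedScore P r x) ^ 2 * smoothedDensity P r x := by
    refine ((iψ2.const_mul 2).add (is2.const_mul 2)).mono'
      ((mD.pow_const 2).mul cf.measurable).aestronglyMeasurable
      (Filter.Eventually.of_forall fun x => ?_)
    have := hfp x
    rw [Real.norm_of_nonneg (by positivity)]
    simp only [Pi.add_apply]
    nlinarith [mul_nonneg (sq_nonneg (ψ x + smoothedScore P r x)) this.le]
  have t1 := abs_setIntegral_mul_density_le hr mD mΔ iD iΔ (Set.Ici (μ + ε))
  have t2 := abs_setIntegral_mul_density_le hr ms mρ is2 iρ (Set.Ici (μ + ε))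
  have t3 := abs_setIntegral_score_sq_sub_le hr hsym ε
  have j1 := integrable_mul_mul_density hr mD mΔ iD iΔ
  have j2 := integrable_mul_mul_density hr ms mρ is2 iρ
  -- The decomposition `ψ Δ = (ψ - s) Δ + s ρ + h s²`, in which only the last term is of leading
  -- order.
  have key : ∫ x in Set.Ici (μ + ε),
        ψ x * (smoothedDensity P r x - smoothedDensity P r (x - h)) =
      (∫ x in Set.Ici (μ + ε), (ψ x - smoothedScore P r x) * Δ x * smoothedDensity P r x)
      + ((∫ x in Set.Ici (μ + ε), smoothedScore P r x *
          (densityRemainder P r h x / smoothedDensity P r x) * smoothedDensity P r x)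
      + h * ∫ x in Set.Ici (μ + ε), smoothedScore P r x ^ 2 * smoothedDensity P r x) := by
    have j3 : Integrable fun x => smoothedScore P r x * (densityRemainder P r h x /
        smoothedDensity P r x) * smoothedDensity P r x
        + h * (smoothedScore P r x ^ 2 * smoothedDensity P r x) := j2.add (is2.const_mul h)
    rw [← integral_const_mul, ← integral_add j2.integrableOn (is2.const_mul h).integrableOn,
      ← integral_add j1.integrableOn j3.integrableOn]
    congr 1; ext x
    rw [eΔ]; simp only [hΔ]; ring
  rw [integral_symmetrized hr hsym hψ hB ε, key]
  set T1 := ∫ x in Set.Ici (μ + ε), (ψ x - smoothedScore P r x) * Δ x * smoothedDensity P r x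
  set T2 := ∫ x in Set.Ici (μ + ε), smoothedScore P r x *
          (densityRemainder P r h x / smoothedDensity P r x) * smoothedDensity P r x
  set T3 := ∫ x in Set.Ici (μ + ε), smoothedScore P r x ^ 2 * smoothedDensity P r x
  set J := ∫ x, (ψ x - smoothedScore P r x) ^ 2 * smoothedDensity P r x
  have b1 : |T1| ≤ √J * √(8 * ε ^ 2 * I + 32 * (ε ^ 4 / r ^ 4)) := t1.trans (by gcongr)
  have b2 : |T2| ≤ √I * (4 * (ε ^ 2 / r ^ 2)) := by
    rw [← smoothedFisherInfo_eq hr] at t2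
    refine t2.trans ?_
    gcongr
    simp_rw [eρ]
    apply Real.sqrt_le_iff.2 ⟨by positivity, bR.trans (le_of_eq ?_)⟩
    rw [hh]; field_simp; ring
  have b3 : |h * (T3 - I / 2)| ≤ 42 * (ε ^ 2 / r ^ 2) * √I := by
    rw [abs_mul, hh, abs_mul, abs_two]
    calc 2 * |ε| * |T3 - I / 2| ≤ 2 * |ε| * (|ε| * (21 * √I / r ^ 2)) := by gcongr
      _ = 42 * (|ε| ^ 2 / r ^ 2) * √I := by ring
      _ = _ := by rw [sq_abs]
  have e : T1 + (T2 + h * T3) - ε * I = T1 + T2 + h * (T3 - I / 2) := by rw [hh]; ring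
  rw [e]
  calc _ ≤ |T1| + |T2| + |h * (T3 - I / 2)| := abs_add_three _ _ _
    _ ≤ _ := by linarith

end Symmetrization

/-! ### Bernstein's inequality for sums of bounded independent variables. -/

section Bernstein

variable {α : Type*} [MeasurableSpace α] {P : Measure α} [IsProbabilityMeasure P] {φ : α → ℝ}
  {b v κ : ℝ}

/-- On `|t| ≤ 1` one has `exp t ≤ 1 + t + t²`; the linear term has mean zero, and `1 + u ≤ exp u`
closes the bound. -/
lemma integral_exp_mul_le (hφ : Measurable φ) (hb : ∀ x, |φ x| ≤ b) (h0 : ∫ x, φ x ∂P = 0)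
    (hv : ∫ x, φ x ^ 2 ∂P ≤ v) {l : ℝ} (hl : 0 ≤ l) (hlb : l * b ≤ 1) :
    ∫ x, Real.exp (l * φ x) ∂P ≤ Real.exp (l ^ 2 * v) := by
  have i1 : Integrable φ P := Integrable.of_bound hφ.aestronglyMeasurable b
    (Filter.Eventually.of_forall hb)
  have i2 : Integrable (fun x => φ x ^ 2) P := Integrable.of_bound
    (hφ.pow_const 2).aestronglyMeasurable (b ^ 2) (Filter.Eventually.of_forall fun x => by
      rw [Real.norm_of_nonneg (sq_nonneg _), ← sq_abs]
      exact pow_le_pow_left₀ (abs_nonneg _) (hb x) 2)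
  have hle : ∀ x, |l * φ x| ≤ 1 := fun x => by
    rw [abs_mul, abs_of_nonneg hl]
    exact (mul_le_mul_of_nonneg_left (hb x) hl).trans hlb
  have i3 : Integrable (fun x => Real.exp (l * φ x)) P := Integrable.of_bound
    (by fun_prop) (Real.exp 1) (Filter.Eventually.of_forall fun x => by
      rw [Real.norm_of_nonneg (Real.exp_pos _).le]
      exact Real.exp_le_exp.2 (le_of_abs_le (hle x)))
  have i12 : Integrable (fun x => 1 + l * φ x) P := (integrable_const 1).add (i1.const_mul l)
  calc ∫ x, Real.exp (l * φ x) ∂P ≤ ∫ x, (1 + l * φ x + l ^ 2 * φ x ^ 2) ∂P := by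
        refine integral_mono i3 (i12.add (i2.const_mul (l ^ 2))) fun x => ?_
        have := le_of_abs_le (Real.abs_exp_sub_one_sub_id_le (hle x))
        simp only
        nlinarith
    _ = 1 + l ^ 2 * ∫ x, φ x ^ 2 ∂P := by
        rw [integral_add i12 (i2.const_mul (l ^ 2)),
          integral_add (integrable_const 1) (i1.const_mul l), integral_const_mul,
          integral_const_mul, h0]
        simp
    _ ≤ 1 + l ^ 2 * v := by gcongr
    _ ≤ Real.exp (l ^ 2 * v) := by linarith [Real.add_one_le_exp (l ^ 2 * v)]

/-- One-sided Bernstein inequality in the sub-Gaussian range. -/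
lemma measureReal_sum_ge_le {N : ℕ} (hφ : Measurable φ) (hb : ∀ x, |φ x| ≤ b)
    (h0 : ∫ x, φ x ∂P = 0) (hv : ∫ x, φ x ^ 2 ∂P ≤ v) (hvp : 0 < v) (hκ : 0 ≤ κ)
    (hκb : κ * b ^ 2 ≤ v) :
    (Measure.pi fun _ : Fin N => P).real {Y | N * (2 * √(κ * v)) ≤ ∑ i, φ (Y i)} ≤
      Real.exp (-(N * κ)) := by
  -- The minimizer of the Chernoff exponent `-2 l √(κ v) + l² v`, with minimum `-κ`. The condition
  -- `κ b² ≤ v` says exactly that `l b ≤ 1` for `b ≥ 0`.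
  set l := √(κ / v) with hl
  have hl0 : 0 ≤ l := Real.sqrt_nonneg _
  have hl2 : l ^ 2 * v = κ := by rw [hl, Real.sq_sqrt (by positivity)]; field_simp
  have hlκ : l * √(κ * v) = κ := by
    rw [hl, ← Real.sqrt_mul (by positivity), show κ / v * (κ * v) = κ ^ 2 by field_simp,
      Real.sqrt_sq hκ]
  have hlb : l * b ≤ 1 := by
    have : (l * b) ^ 2 ≤ 1 := by
      rw [mul_pow, hl, Real.sq_sqrt (by positivity), div_mul_eq_mul_div, div_le_one hvp]
      exact hκb
    nlinarith
  have hm : Measurable fun Y : Fin N → α => ∑ i, φ (Y i) := by fun_prop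
  have hi : Integrable (fun Y : Fin N → α => Real.exp (l * ∑ i, φ (Y i)))
      (Measure.pi fun _ : Fin N => P) := by
    refine Integrable.of_bound (hm.const_mul l).exp.aestronglyMeasurable (Real.exp (l * ∑ _i : Fin N, b))
      (Filter.Eventually.of_forall fun Y => ?_)
    rw [Real.norm_of_nonneg (Real.exp_pos _).le]
    exact Real.exp_le_exp.2 (mul_le_mul_of_nonneg_left
      (Finset.sum_le_sum fun i _ => le_of_abs_le (hb _)) hl0)
  have hmgf : mgf (fun Y : Fin N → α => ∑ i, φ (Y i)) (Measure.pi fun _ : Fin N => P) l ≤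
      Real.exp (N * κ) := by
    rw [mgf]
    simp_rw [Finset.mul_sum, Real.exp_sum]
    rw [integral_fintype_prod_eq_prod (fun (_ : Fin N) y => Real.exp (l * φ y))]
    rw [Finset.prod_const, Finset.card_univ, Fintype.card_fin, Real.exp_nat_mul]
    refine pow_le_pow_left₀ (integral_nonneg fun _ => (Real.exp_pos _).le) ?_ N
    rw [← hl2]
    exact integral_exp_mul_le hφ hb h0 hv hl0 hlb
  calc _ ≤ Real.exp (-l * (N * (2 * √(κ * v)))) *
        mgf (fun Y : Fin N → α => ∑ i, φ (Y i)) (Measure.pi fun _ : Fin N => P) l :=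
        measure_ge_le_exp_mul_mgf _ hl0 hi
    _ ≤ Real.exp (-l * (N * (2 * √(κ * v)))) * Real.exp (N * κ) := by gcongr
    _ = Real.exp (-(N * κ)) := by
        rw [← Real.exp_add]
        congr 1
        linear_combination -2 * N * hlκ

/-- Two-sided Bernstein inequality in the sub-Gaussian range. -/
lemma measure_lt_abs_sum_le {N : ℕ} (hφ : Measurable φ) (hb : ∀ x, |φ x| ≤ b)
    (h0 : ∫ x, φ x ∂P = 0) (hv : ∫ x, φ x ^ 2 ∂P ≤ v) (hvp : 0 < v) (hκ : 0 ≤ κ)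
    (hκb : κ * b ^ 2 ≤ v) :
    (Measure.pi fun _ : Fin N => P) {Y | N * (2 * √(κ * v)) < |∑ i, φ (Y i)|} ≤
      ENNReal.ofReal (2 * Real.exp (-(N * κ))) := by
  have h1 := measureReal_sum_ge_le (N := N) hφ hb h0 hv hvp hκ hκb
  have h2 := measureReal_sum_ge_le (N := N) (φ := fun x => -φ x) hφ.neg (by simpa using hb)
    (by rw [integral_neg, h0, neg_zero]) (by simpa using hv) hvp hκ hκb
  rw [← ofReal_measureReal]
  refine ENNReal.ofReal_le_ofReal ?_
  refine (measureReal_mono (s₂ := {Y : Fin N → α | N * (2 * √(κ * v)) ≤ ∑ i, φ (Y i)} ∪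
    {Y : Fin N → α | N * (2 * √(κ * v)) ≤ ∑ i, -φ (Y i)}) ?_).trans
    ((measureReal_union_le _ _).trans (by linarith))
  intro Y hY
  rw [Set.mem_ofPred_eq, lt_abs] at hY
  rcases hY with hY | hY
  · exact Or.inl hY.le
  · refine Or.inr ?_
    rw [Set.mem_ofPred_eq, Finset.sum_neg_distrib]; exact hY.le

end Bernstein

/-- If each section of `S` in one variable has small measure, then with high probability the
section in the other variable has small measure. -/
lemma measure_le_measure_section_le {Ω α : Type*} [MeasurableSpace Ω] [MeasurableSpace α]
    {Q : Measure Ω} [IsProbabilityMeasure Q] {ν : Measure α} [IsProbabilityMeasure ν]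
    {S : Set (Ω × α)} (hS : MeasurableSet S) {p η : ℝ≥0∞}
    (hp : ∀ x, Q {ω | (ω, x) ∈ S} ≤ p) (hη : η ≠ 0) (hη' : η ≠ ⊤) :
    Q {ω | η ≤ ν {x | (ω, x) ∈ S}} ≤ p / η := by
  -- Fubini bounds the expected mass of a section; Markov's inequality then finishes.
  have h1 : ∫⁻ ω, ν {x | (ω, x) ∈ S} ∂Q ≤ p := by
    calc ∫⁻ ω, ν {x | (ω, x) ∈ S} ∂Q = (Q.prod ν) S := (Measure.prod_apply hS).symm
      _ = ∫⁻ x, Q {ω | (ω, x) ∈ S} ∂ν := Measure.prod_apply_symm hS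
      _ ≤ ∫⁻ _, p ∂ν := lintegral_mono hp
      _ = p := by simp
  rw [ENNReal.le_div_iff_mul_le (Or.inl hη) (Or.inl hη'), mul_comm]
  exact (mul_meas_ge_le_lintegral (measurable_measure_prodMk_left hS) η).trans h1

/-! ### Pointwise accuracy of the kernel density estimate and of its score. -/

section KDE

variable {P : Measure ℝ} [IsProbabilityMeasure P] {r κ : ℝ} {N : ℕ}

/-- The derivative of the kernel density estimate. -/
noncomputable def kdeDeriv (Y : Fin N → ℝ) (r x : ℝ) : ℝ :=
  (1 / (N : ℝ)) * ∑ i, gaussKernelDeriv r (x - Y i)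

lemma hasDerivAt_kde (hr : 0 < r) (Y : Fin N → ℝ) (x : ℝ) :
    HasDerivAt (kde Y r) (kdeDeriv Y r x) x := by
  refine HasDerivAt.const_mul _ (HasDerivAt.fun_sum fun i _ => ?_)
  exact (hasDerivAt_gaussKernel hr (x - Y i)).comp_sub_const x (Y i)

lemma score_kde (hr : 0 < r) (Y : Fin N → ℝ) (x : ℝ) :
    score (kde Y r) x = kdeDeriv Y r x / kde Y r x := by
  rw [score, (hasDerivAt_kde hr Y x).deriv]

lemma continuous_kde (hr : 0 < r) : Continuous fun p : (Fin N → ℝ) × ℝ => kde p.1 r p.2 := by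
  have := continuous_gaussKernel hr
  unfold kde
  fun_prop

lemma continuous_kdeDeriv (hr : 0 < r) :
    Continuous fun p : (Fin N → ℝ) × ℝ => kdeDeriv p.1 r p.2 := by
  have := continuous_gaussKernelDeriv hr
  unfold kdeDeriv
  fun_prop

/-- The variance proxy `f (1 + r² s²) / r³` of the linearized score error. -/
noncomputable def scoreVar (P : Measure ℝ) (r x : ℝ) : ℝ :=
  smoothedDensity P r x * (1 + r ^ 2 * smoothedScore P r x ^ 2) / r ^ 3

/-- The pairs of a sample and a point at which the kernel density estimate is inaccurate. -/
def badSet (P : Measure ℝ) (N : ℕ) (r κ : ℝ) : Set ((Fin N → ℝ) × ℝ) :=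
  {p | 2 * √(κ * (smoothedDensity P r p.2 / (2 * r))) < |kde p.1 r p.2 - smoothedDensity P r p.2| ∨
    2 * √(κ * scoreVar P r p.2) < |kdeDeriv p.1 r p.2 - smoothedScore P r p.2 * kde p.1 r p.2|}

lemma continuous_scoreVar (hr : 0 < r) : Continuous (scoreVar P r) := by
  have h1 := continuous_smoothedDensity (P := P) hr
  have h2 := continuous_smoothedScore (P := P) hr
  unfold scoreVar
  fun_prop

lemma measurableSet_badSet (hr : 0 < r) : MeasurableSet (badSet P N r κ) := by
  have h1 := continuous_smoothedDensity (P := P) hr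
  have h2 := continuous_smoothedScore (P := P) hr
  have h3 := continuous_scoreVar (P := P) hr
  have h4 := continuous_kde (N := N) hr
  have h5 := continuous_kdeDeriv (N := N) hr
  have m1 : Continuous fun p : (Fin N → ℝ) × ℝ =>
    2 * √(κ * (smoothedDensity P r p.2 / (2 * r))) := by fun_prop
  have m2 : Continuous fun p : (Fin N → ℝ) × ℝ =>
    |kde p.1 r p.2 - smoothedDensity P r p.2| := by fun_prop
  have m3 : Continuous fun p : (Fin N → ℝ) × ℝ => 2 * √(κ * scoreVar P r p.2) := by fun_prop
  have m4 : Continuous fun p : (Fin N → ℝ) × ℝ =>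
    |kdeDeriv p.1 r p.2 - smoothedScore P r p.2 * kde p.1 r p.2| :=
    (h5.sub ((h2.comp continuous_snd).mul h4)).abs
  exact (measurableSet_lt m1.measurable m2.measurable).union
    (measurableSet_lt m3.measurable m4.measurable)

/-- Bernstein with range and variance controlled by `sup w ≤ 1 / (2r)`. For these bounds the
sub-Gaussian condition `κ b² ≤ v` is precisely `κ ≤ 2 r f`. -/
lemma measure_kde_error_le (hr : 0 < r) (hN : 0 < N) (hκ : 0 ≤ κ) (x : ℝ)
    (hx : κ ≤ 2 * (r * smoothedDensity P r x)) :
    (Measure.pi fun _ : Fin N => P) {Y | 2 * √(κ * (smoothedDensity P r x / (2 * r))) <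
      |kde Y r x - smoothedDensity P r x|} ≤ ENNReal.ofReal (2 * Real.exp (-(N * κ))) := by
  have hc := continuous_gaussKernel hr
  have hf := smoothedDensity_pos (P := P) hr x
  have hN' : (0 : ℝ) < N := by exact_mod_cast hN
  set f := smoothedDensity P r x with hfd
  have i1 := integrable_gaussKernel_translate (P := P) hr x
  have hf1 : f ≤ 1 / (2 * r) := by
    calc f ≤ ∫ _, 1 / (2 * r) ∂P := integral_mono i1 (integrable_const _)
          fun y => gaussKernel_le hr _
      _ = _ := by simp
  have hb : ∀ y, |gaussKernel r (x - y) - f| ≤ 1 / (2 * r) := fun y => by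
    have h1 := gaussKernel_pos hr (x - y)
    have h2 := gaussKernel_le hr (x - y)
    rw [abs_le]; constructor <;> linarith
  have h0 : ∫ y, (gaussKernel r (x - y) - f) ∂P = 0 := by
    rw [integral_sub i1 (integrable_const _), integral_const, probReal_univ, one_smul]
    exact sub_self _
  have hv : ∫ y, (gaussKernel r (x - y) - f) ^ 2 ∂P ≤ f / (2 * r) := by
    calc ∫ y, (gaussKernel r (x - y) - f) ^ 2 ∂P
        ≤ ∫ y, ((1 / (2 * r) - 2 * f) * gaussKernel r (x - y) + f ^ 2) ∂P := by
          refine integral_mono (Integrable.of_bound (by fun_prop) ((1 / (2 * r)) ^ 2)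
            (Filter.Eventually.of_forall fun y => ?_))
            ((i1.const_mul _).add (integrable_const _)) fun y => ?_
          · rw [Real.norm_of_nonneg (sq_nonneg _), ← sq_abs]
            exact pow_le_pow_left₀ (abs_nonneg _) (hb y) 2
          · have h1 := gaussKernel_pos hr (x - y)
            have h2 := gaussKernel_le hr (x - y)
            simp only
            nlinarith
      _ = (1 / (2 * r) - 2 * f) * f + f ^ 2 := by
          rw [integral_add (i1.const_mul _) (integrable_const _), integral_const_mul,
            integral_const, probReal_univ, one_smul]
          rfl
      _ ≤ _ := by
          have : f / (2 * r) = 1 / (2 * r) * f := by ring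
          nlinarith
  have h := measure_lt_abs_sum_le (P := P) (N := N) (κ := κ) (by fun_prop) hb h0 hv (by positivity)
    hκ (by
      rw [show κ * (1 / (2 * r)) ^ 2 = κ / (4 * r ^ 2) by ring,
        show f / (2 * r) = (2 * (r * f)) / (4 * r ^ 2) by field_simp; ring]
      gcongr)
  refine le_trans (measure_mono fun Y hY => ?_) h
  rw [Set.mem_ofPred_eq] at hY ⊢
  have e : ∑ i, (gaussKernel r (x - Y i) - f) = N * (kde Y r x - f) := by
    rw [Finset.sum_sub_distrib, kde]; simp; field_simp
  rw [e, abs_mul, abs_of_pos hN']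
  gcongr

/-- The score error is this quantity divided by the density estimate. It is a sample average of `w'
- s w`, which has mean `f' - s f = 0`, so Bernstein applies to it directly. -/
lemma measure_scoreError_le (hr : 0 < r) (hN : 0 < N) (hκ : 0 ≤ κ) (x : ℝ)
    (hx : κ ≤ 2 * (r * smoothedDensity P r x)) :
    (Measure.pi fun _ : Fin N => P) {Y | 2 * √(κ * scoreVar P r x) <
      |kdeDeriv Y r x - smoothedScore P r x * kde Y r x|} ≤
      ENNReal.ofReal (2 * Real.exp (-(N * κ))) := by
  have hc := continuous_gaussKernel hr
  have hc' := continuous_gaussKernelDeriv hr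
  have hf := smoothedDensity_pos (P := P) hr x
  have hN' : (0 : ℝ) < N := by exact_mod_cast hN
  have i1 := integrable_gaussKernel_translate (P := P) hr x
  have i2 := integrable_gaussKernelDeriv_translate (P := P) hr x
  have hs := smoothedScore_mul (P := P) hr x
  rw [scoreVar]
  set f := smoothedDensity P r x with hfd
  set s := smoothedScore P r x with hsd
  set b := 1 / (2 * r ^ 2) + |s| * (1 / (2 * r)) with hbd
  have hb : ∀ y, |gaussKernelDeriv r (x - y) - s * gaussKernel r (x - y)| ≤ b := fun y => by
    refine (abs_sub _ _).trans ?_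
    rw [abs_mul]
    have h1 := abs_gaussKernelDeriv_le hr (x - y)
    have h2 := abs_gaussKernel_le hr (x - y)
    rw [hbd]; gcongr
  have h0 : ∫ y, (gaussKernelDeriv r (x - y) - s * gaussKernel r (x - y)) ∂P = 0 := by
    rw [integral_sub i2 (i1.const_mul _), integral_const_mul]
    change smoothedDeriv P r x - s * f = 0
    linarith
  have hv : ∫ y, (gaussKernelDeriv r (x - y) - s * gaussKernel r (x - y)) ^ 2 ∂P ≤
      f * (1 + r ^ 2 * s ^ 2) / r ^ 3 := by
    calc _ ≤ ∫ y, (1 + r ^ 2 * s ^ 2) / r ^ 3 * gaussKernel r (x - y) ∂P := by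
          refine integral_mono (Integrable.of_bound (by fun_prop) (b ^ 2)
            (Filter.Eventually.of_forall fun y => ?_)) (i1.const_mul _) fun y => ?_
          · rw [Real.norm_of_nonneg (sq_nonneg _), ← sq_abs]
            exact pow_le_pow_left₀ (abs_nonneg _) (hb y) 2
          · simp only
            set z := x - y
            have h1 := gaussKernel_pos hr z
            have h2 := gaussKernel_le hr z
            have h3 := sq_mul_gaussKernel_le hr z
            have e1 : gaussKernelDeriv r z - s * gaussKernel r z =
              -(z / r ^ 2 + s) * gaussKernel r z := by rw [gaussKernelDeriv]; ring
            rw [e1]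
            have h4 : (z / r ^ 2 + s) ^ 2 * gaussKernel r z ≤ (1 + r ^ 2 * s ^ 2) / r ^ 3 := by
              calc _ ≤ (2 * (z / r ^ 2) ^ 2 + 2 * s ^ 2) * gaussKernel r z := by
                    gcongr; nlinarith [sq_nonneg (z / r ^ 2 - s)]
                _ = 2 / r ^ 4 * (z ^ 2 * gaussKernel r z) + 2 * s ^ 2 * gaussKernel r z := by ring
                _ ≤ 2 / r ^ 4 * (r / 2) + 2 * s ^ 2 * (1 / (2 * r)) := by gcongr
                _ = _ := by field_simp
            calc _ = (z / r ^ 2 + s) ^ 2 * gaussKernel r z * gaussKernel r z := by ring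
              _ ≤ _ := by gcongr
      _ = _ := by
          rw [integral_const_mul]
          change _ * f = _
          ring
  have h := measure_lt_abs_sum_le (P := P) (N := N) (κ := κ) (by fun_prop) hb h0 hv (by positivity)
    hκ (by
      have h1 : b ^ 2 ≤ (1 + r ^ 2 * s ^ 2) / (2 * r ^ 4) := by
        have h2 : b ^ 2 ≤ 2 * (1 / (2 * r ^ 2)) ^ 2 + 2 * (|s| * (1 / (2 * r))) ^ 2 := by
          rw [hbd]; nlinarith [sq_nonneg (1 / (2 * r ^ 2) - |s| * (1 / (2 * r)))]
        refine h2.trans (le_of_eq ?_)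
        rw [mul_pow |s|, sq_abs]; field_simp
      calc κ * b ^ 2 ≤ (2 * (r * f)) * ((1 + r ^ 2 * s ^ 2) / (2 * r ^ 4)) := by gcongr
        _ = _ := by field_simp)
  refine le_trans (measure_mono fun Y hY => ?_) h
  rw [Set.mem_ofPred_eq] at hY ⊢
  have e : ∑ i, (gaussKernelDeriv r (x - Y i) - s * gaussKernel r (x - Y i)) =
      N * (kdeDeriv Y r x - s * kde Y r x) := by
    rw [Finset.sum_sub_distrib, ← Finset.mul_sum, kde, kdeDeriv]; field_simp
  rw [e, abs_mul, abs_of_pos hN']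
  gcongr

lemma measure_badSet_section_le (hr : 0 < r) (hN : 0 < N) (hκ : 0 ≤ κ) (x : ℝ)
    (hx : κ ≤ 2 * (r * smoothedDensity P r x)) :
    (Measure.pi fun _ : Fin N => P) {Y | (Y, x) ∈ badSet P N r κ} ≤
      ENNReal.ofReal (4 * Real.exp (-(N * κ))) := by
  rw [show 4 * Real.exp (-(N * κ)) = 2 * Real.exp (-(N * κ)) + 2 * Real.exp (-(N * κ)) by ring,
    ENNReal.ofReal_add (by positivity) (by positivity)]
  exact (measure_union_le _ _).trans (add_le_add (measure_kde_error_le hr hN hκ x hx)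
    (measure_scoreError_le hr hN hκ x hx))

/-- Accuracy of the score of the kernel density estimate off the bad set. -/
lemma sq_score_sub_mul_density_le (hr : 0 < r) {Y : Fin N → ℝ} {x : ℝ} (hκ : 0 ≤ κ)
    (hx : 8 * κ ≤ r * smoothedDensity P r x) (hY : (Y, x) ∉ badSet P N r κ) :
    (score (kde Y r) x - smoothedScore P r x) ^ 2 * smoothedDensity P r x ≤
      16 * κ * (1 + r ^ 2 * smoothedScore P r x ^ 2) / r ^ 3 := by
  have hf := smoothedDensity_pos (P := P) hr x
  simp only [badSet, Set.mem_ofPred_eq, not_or, not_lt] at hY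
  obtain ⟨h1, h2⟩ := hY
  rw [scoreVar] at h2
  rw [score_kde hr]
  set f := smoothedDensity P r x
  set s := smoothedScore P r x
  set g := kde Y r x
  set t := kdeDeriv Y r x - s * g with ht
  -- The hypothesis `8κ ≤ r f` is exactly what makes the allowed density deviation at most `f / 2`.
  have hg : f / 2 ≤ g := by
    have h3 : 2 * √(κ * (f / (2 * r))) ≤ f / 2 := by
      have : √(κ * (f / (2 * r))) ≤ f / 4 := by
        apply Real.sqrt_le_iff.2 ⟨by positivity, ?_⟩
        rw [mul_div_assoc', div_le_iff₀ (by positivity)]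
        nlinarith
      linarith
    have := (abs_le.1 (h1.trans h3)).1
    linarith
  have hgp : 0 < g := by linarith
  have ht2 : t ^ 2 ≤ 4 * (κ * (f * (1 + r ^ 2 * s ^ 2) / r ^ 3)) := by
    have := pow_le_pow_left₀ (abs_nonneg _) h2 2
    rwa [sq_abs, mul_pow, Real.sq_sqrt (by positivity), show (2 : ℝ) ^ 2 = 4 by norm_num] at this
  have e : kdeDeriv Y r x / g - s = t / g := by rw [ht]; field_simp
  rw [e, div_pow, div_mul_eq_mul_div, div_le_iff₀ (by positivity)]
  calc t ^ 2 * f ≤ 4 * (κ * (f * (1 + r ^ 2 * s ^ 2) / r ^ 3)) * f := by gcongr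
    _ = 16 * κ * (1 + r ^ 2 * s ^ 2) / r ^ 3 * (f / 2) ^ 2 := by ring
    _ ≤ _ := by gcongr

end KDE

/-! ### Clipping as projection onto an interval. -/

section Clip

lemma sign_mul_min_abs {c : ℝ} (hc : 0 ≤ c) (u : ℝ) :
    Real.sign u * min |u| c = max (-c) (min u c) := by
  rcases lt_trichotomy u 0 with hu | hu | hu
  · rw [Real.sign_of_neg hu, abs_of_neg hu, min_eq_left (hu.le.trans hc), neg_one_mul,
      ← max_neg_neg, neg_neg, max_comm]
  · simp [hu, hc]
  · rw [Real.sign_of_pos hu, abs_of_pos hu, one_mul, max_eq_right]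
    exact (neg_nonpos.2 hc).trans (le_min hu.le hc)

lemma abs_clip_le {c : ℝ} (hc : 0 ≤ c) (u : ℝ) : |max (-c) (min u c)| ≤ c :=
  abs_le.2 ⟨le_max_left _ _, max_le (by linarith) (min_le_right _ _)⟩

/-- Projection onto `[-c, c]` is 1-Lipschitz and fixes `s`. -/
lemma sq_clip_sub_le {c s : ℝ} (hs : |s| ≤ c) (u : ℝ) :
    (max (-c) (min u c) - s) ^ 2 ≤ (u - s) ^ 2 := by
  obtain ⟨h1, h2⟩ := abs_le.1 hs
  have e : s = max (-c) (min s c) := by rw [min_eq_left h2, max_eq_right h1]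
  rw [← sq_abs, ← sq_abs (u - s)]
  refine pow_le_pow_left₀ (abs_nonneg _) ?_ 2
  conv_lhs => rw [e]
  calc |max (-c) (min u c) - max (-c) (min s c)| ≤ |min u c - min s c| := by
        simpa using abs_max_sub_max_le_max (-c) (min u c) (-c) (min s c)
    _ ≤ |u - s| := by simpa using abs_min_sub_min_le_max u c s c

variable {N : ℕ} {r δ : ℝ}

lemma clippedScore_eq (hr : 0 < r) (Y : Fin N → ℝ) (x : ℝ) :
    clippedScore Y r δ x = max (-(2 / r * √(Real.log (N / Real.log (1 / δ)))))
      (min (score (kde Y r) x) (2 / r * √(Real.log (N / Real.log (1 / δ))))) := by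
  rw [clippedScore, sign_mul_min_abs (by positivity)]

lemma abs_clippedScore_le (hr : 0 < r) (Y : Fin N → ℝ) (x : ℝ) :
    |clippedScore Y r δ x| ≤ 2 / r * √(Real.log (N / Real.log (1 / δ))) := by
  rw [clippedScore_eq hr]
  exact abs_clip_le (by positivity) _

lemma measurable_clippedScore (hr : 0 < r) (Y : Fin N → ℝ) : Measurable (clippedScore Y r δ) := by
  have h1 : Measurable fun x => kde Y r x :=
    ((continuous_kde hr).comp (by fun_prop : Continuous fun x : ℝ => (Y, x))).measurable
  have h2 : Measurable fun x => kdeDeriv Y r x :=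
    ((continuous_kdeDeriv hr).comp (by fun_prop : Continuous fun x : ℝ => (Y, x))).measurable
  rw [show clippedScore Y r δ = _ from funext (clippedScore_eq hr Y)]
  simp_rw [score_kde hr]
  exact measurable_const.max ((h2.div h1).min measurable_const)

end Clip

/-! ### Mean square error of the clipped score, with every scale a power of `q`. -/

section MeanSquare

variable {P : Measure ℝ} [IsProbabilityMeasure P] {r μ σ δ q : ℝ} {N : ℕ}

/-- The bound `r² s² / 2 ≤ log (1 / (r f))` with `r f ≥ q⁻²²`. The squared clipping level is `96 log
q / r²`, so at such points clipping does not exclude the true score. -/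
lemma sq_mul_score_sq_le (hr : 0 < r) (hq : 0 < q) {x : ℝ}
    (hx : (q ^ 22)⁻¹ ≤ r * smoothedDensity P r x) :
    r ^ 2 * smoothedScore P r x ^ 2 ≤ 44 * Real.log q := by
  have h := exp_score_mul_density_le (P := P) hr x
  have hf := smoothedDensity_pos (P := P) hr x
  have h1 : Real.exp (r ^ 2 * smoothedScore P r x ^ 2 / 2) ≤ q ^ 22 := by
    set E := Real.exp (r ^ 2 * smoothedScore P r x ^ 2 / 2)
    have hE : 0 < E := Real.exp_pos _
    have h2 : E * (r * smoothedDensity P r x) ≤ 1 := by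
      calc E * (r * smoothedDensity P r x) = E * smoothedDensity P r x * r := by ring
        _ ≤ 1 / (2 * r) * r := by gcongr
        _ ≤ 1 := by field_simp; norm_num
    have h3 : E * (q ^ 22)⁻¹ ≤ 1 := (by gcongr : _ ≤ E * (r * smoothedDensity P r x)).trans h2
    rwa [← div_eq_mul_inv, div_le_one (by positivity)] at h3
  have h2 := Real.log_le_log (Real.exp_pos _) h1
  rw [Real.log_exp, Real.log_pow] at h2
  push_cast at h2
  linarith

/-- The bad pairs at which the smoothed density is not too small. -/
def relevantBadSet (P : Measure ℝ) (N : ℕ) (r q : ℝ) : Set ((Fin N → ℝ) × ℝ) :=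
  badSet P N r (q ^ 23)⁻¹ ∩ {p | (q ^ 22)⁻¹ ≤ r * smoothedDensity P r p.2}

lemma measurableSet_relevantBadSet (hr : 0 < r) : MeasurableSet (relevantBadSet P N r q) := by
  have h1 := continuous_smoothedDensity (P := P) hr
  have m1 : Continuous fun p : (Fin N → ℝ) × ℝ => r * smoothedDensity P r p.2 := by fun_prop
  exact (measurableSet_badSet hr).inter (measurableSet_le measurable_const m1.measurable)

/-- Pointwise bound on the error of the clipped score. -/
lemma sq_clippedScore_sub_mul_density_le (hr : 0 < r) (hq : 8 ≤ q)
    (hM : N / Real.log (1 / δ) = q ^ 24) (Y : Fin N → ℝ) (x : ℝ) :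
    (clippedScore Y r δ x - smoothedScore P r x) ^ 2 * smoothedDensity P r x ≤
      (720 / (q ^ 22 * r ^ 3) + 384 * q / r ^ 2 * (1 / (q ^ 22 * r))) *
        (Set.Icc (μ - r * q ^ 10) (μ + r * q ^ 10)).indicator 1 x +
      384 * q / r ^ 2 / (r * q ^ 10) ^ 2 * ((x - μ) ^ 2 * smoothedDensity P r x) +
      384 * q / r ^ 2 *
        {x | (Y, x) ∈ relevantBadSet P N r q}.indicator (smoothedDensity P r) x +
      8 / (r ^ 2 * q ^ 24) *
        (Real.exp (r ^ 2 * smoothedScore P r x ^ 2 / 4) * smoothedDensity P r x) := by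
  have hq0 : 0 < q := by linarith
  have hf := smoothedDensity_pos (P := P) hr x
  have hlog : Real.log q ≤ q - 1 := Real.log_le_sub_one_of_pos hq0
  have hlog0 : 0 ≤ Real.log q := Real.log_nonneg (by linarith)
  have hlogM : Real.log (N / Real.log (1 / δ)) = 24 * Real.log q := by
    rw [hM, Real.log_pow]; push_cast; rfl
  have hbad0 : 0 ≤ {x | (Y, x) ∈ relevantBadSet P N r q}.indicator (smoothedDensity P r) x :=
    Set.indicator_nonneg (fun x _ => (smoothedDensity_pos hr x).le) x
  have hind0 : (0 : ℝ) ≤ (Set.Icc (μ - r * q ^ 10) (μ + r * q ^ 10)).indicator 1 x :=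
    Set.indicator_nonneg (fun _ _ => zero_le_one) x
  -- A bound needing no accuracy of the estimate, for use at low density, on the bad set and in the
  -- tails.
  have hcrude : (clippedScore Y r δ x - smoothedScore P r x) ^ 2 * smoothedDensity P r x ≤
      384 * q / r ^ 2 * smoothedDensity P r x + 8 / (r ^ 2 * q ^ 24) *
        (Real.exp (r ^ 2 * smoothedScore P r x ^ 2 / 4) * smoothedDensity P r x) := by
    have h1 : clippedScore Y r δ x ^ 2 ≤ 96 * q / r ^ 2 := by
      have := pow_le_pow_left₀ (abs_nonneg _) (abs_clippedScore_le (δ := δ) hr Y x) 2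
      rw [sq_abs, mul_pow, hlogM, Real.sq_sqrt (by positivity)] at this
      calc _ ≤ _ := this
        _ = 96 * Real.log q / r ^ 2 := by ring
        _ ≤ _ := by gcongr; linarith
    have h2 : smoothedScore P r x ^ 2 ≤ 96 * q / r ^ 2 +
        4 / (r ^ 2 * q ^ 24) * Real.exp (r ^ 2 * smoothedScore P r x ^ 2 / 4) := by
      set u := r ^ 2 * smoothedScore P r x ^ 2 / 4 with hu
      -- The tangent line of the exponential at `24 log q` gives `u ≤ 24 log q + exp u / q²⁴`, so
      -- large scores are charged to the exponential moment with weight `q⁻²⁴`.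
      have h3 := Real.add_one_le_exp (u - 24 * Real.log q)
      have h4 : Real.exp (u - 24 * Real.log q) = Real.exp u / q ^ 24 := by
        rw [Real.exp_sub, show 24 * Real.log q = Real.log (q ^ 24) by
          rw [Real.log_pow]; push_cast; rfl, Real.exp_log (by positivity)]
      rw [h4] at h3
      have h5 : smoothedScore P r x ^ 2 = 4 / r ^ 2 * u := by rw [hu]; field_simp
      calc smoothedScore P r x ^ 2 = 4 / r ^ 2 * u := h5
        _ ≤ 4 / r ^ 2 * (24 * q + Real.exp u / q ^ 24) := by gcongr; linarith
        _ = _ := by field_simp; ring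
    calc _ ≤ (2 * clippedScore Y r δ x ^ 2 + 2 * smoothedScore P r x ^ 2) *
          smoothedDensity P r x := by
          gcongr; nlinarith [sq_nonneg (clippedScore Y r δ x + smoothedScore P r x)]
      _ ≤ (2 * (96 * q / r ^ 2) + 2 * (96 * q / r ^ 2 +
        4 / (r ^ 2 * q ^ 24) * Real.exp (r ^ 2 * smoothedScore P r x ^ 2 / 4))) *
          smoothedDensity P r x := by gcongr
      _ = _ := by ring
  have hT2 : 0 ≤ 384 * q / r ^ 2 / (r * q ^ 10) ^ 2 * ((x - μ) ^ 2 * smoothedDensity P r x) := by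
    positivity
  have hT3 : 0 ≤ 384 * q / r ^ 2 *
      {x | (Y, x) ∈ relevantBadSet P N r q}.indicator (smoothedDensity P r) x := by positivity
  have hT4 : 0 ≤ 8 / (r ^ 2 * q ^ 24) *
        (Real.exp (r ^ 2 * smoothedScore P r x ^ 2 / 4) * smoothedDensity P r x) := by positivity
  by_cases hx : x ∈ Set.Icc (μ - r * q ^ 10) (μ + r * q ^ 10)
  · rw [Set.indicator_of_mem hx, Pi.one_apply, mul_one]
    have hA1 : 0 ≤ 720 / (q ^ 22 * r ^ 3) := by positivity
    have hA2 : 0 ≤ 384 * q / r ^ 2 * (1 / (q ^ 22 * r)) := by positivity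
    by_cases hd : (q ^ 22)⁻¹ ≤ r * smoothedDensity P r x
    · by_cases hb : (Y, x) ∈ relevantBadSet P N r q
      · rw [Set.indicator_of_mem (show x ∈ {x | (Y, x) ∈ relevantBadSet P N r q} from hb)] at hT3 ⊢
        linarith
      · have hb' : (Y, x) ∉ badSet P N r (q ^ 23)⁻¹ := fun h => hb ⟨h, hd⟩
        have hs := sq_mul_score_sq_le hr hq0 hd
        have hsc : |smoothedScore P r x| ≤ 2 / r * √(Real.log (N / Real.log (1 / δ))) := by
          apply abs_le_of_sq_le_sq _ (by positivity)
          rw [mul_pow, hlogM, Real.sq_sqrt (by positivity), div_pow, div_mul_eq_mul_div,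
            le_div_iff₀ (by positivity)]
          linarith
        -- The density threshold exceeds `κ = q⁻²³` by a factor `q ≥ 8`, which is the margin needed
        -- to divide by the density estimate.
        have h8 : 8 * (q ^ 23)⁻¹ ≤ r * smoothedDensity P r x := by
          refine le_trans ?_ hd
          rw [show (q ^ 22)⁻¹ = q * (q ^ 23)⁻¹ by field_simp]
          gcongr
        have hg := sq_score_sub_mul_density_le hr (by positivity) h8 hb'
        have hclip := sq_clip_sub_le hsc (score (kde Y r) x)
        rw [← clippedScore_eq hr] at hclip
        have : (clippedScore Y r δ x - smoothedScore P r x) ^ 2 * smoothedDensity P r x ≤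
            720 / (q ^ 22 * r ^ 3) := by
          calc _ ≤ (score (kde Y r) x - smoothedScore P r x) ^ 2 * smoothedDensity P r x := by
                gcongr
            _ ≤ _ := hg
            -- Uses `1 + 44 log q ≤ 45 q`.
            _ ≤ 16 * (q ^ 23)⁻¹ * (45 * q) / r ^ 3 := by gcongr; linarith
            _ = _ := by field_simp; norm_num
        linarith
    · have : smoothedDensity P r x ≤ 1 / (q ^ 22 * r) := by
        rw [le_div_iff₀ (by positivity)]
        have := (not_le.1 hd).le
        rw [← one_div, le_div_iff₀ (by positivity)] at this
        linarith
      have : 384 * q / r ^ 2 * smoothedDensity P r x ≤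
          384 * q / r ^ 2 * (1 / (q ^ 22 * r)) := by gcongr
      linarith
  · rw [Set.indicator_of_notMem hx, mul_zero]
    have h1 : (r * q ^ 10) ^ 2 ≤ (x - μ) ^ 2 := by
      rw [sq_le_sq, abs_of_pos (a := r * q ^ 10) (by positivity)]
      by_contra h
      obtain ⟨h2, h3⟩ := abs_lt.1 (not_le.1 h)
      exact hx ⟨by linarith, by linarith⟩
    have : 384 * q / r ^ 2 * smoothedDensity P r x ≤
        384 * q / r ^ 2 / (r * q ^ 10) ^ 2 * ((x - μ) ^ 2 * smoothedDensity P r x) := by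
      rw [div_mul_eq_mul_div _ ((r * q ^ 10) ^ 2), le_div_iff₀ (by positivity)]
      calc 384 * q / r ^ 2 * smoothedDensity P r x * (r * q ^ 10) ^ 2
          ≤ 384 * q / r ^ 2 * smoothedDensity P r x * (x - μ) ^ 2 := by gcongr
        _ = _ := by ring
    linarith

lemma setIntegral_density_le (hr : 0 < r) {A : Set ℝ} (hA : MeasurableSet A) {η : ℝ} (hη : 0 ≤ η)
    (h : smoothedLaw P r A ≤ ENNReal.ofReal η) :
    ∫ x, A.indicator (smoothedDensity P r) x ≤ η := by
  rw [integral_indicator hA]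
  rw [smoothedLaw, withDensity_apply _ hA, ← ofReal_integral_eq_lintegral_ofReal
    integrable_smoothedDensity.integrableOn
    (Filter.Eventually.of_forall fun x => (smoothedDensity_pos hr x).le)] at h
  exact (ENNReal.ofReal_le_ofReal_iff hη).1 h

/-- The mean square error of the clipped score of the kernel density estimate. -/
lemma integral_sq_clippedScore_sub_le (hr : 0 < r) (hrσ : r ≤ σ)
    (hP : MemLp (fun x : ℝ => x) 2 P) (hmean : ∫ x, x ∂P = μ)
    (hvar : variance (fun x : ℝ => x) P = σ ^ 2) (hq : 8 ≤ q)
    (hM : N / Real.log (1 / δ) = q ^ 24) (Y : Fin N → ℝ)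
    (hY : smoothedLaw P r {x | (Y, x) ∈ relevantBadSet P N r q} ≤ ENNReal.ofReal (q ^ 24)⁻¹) :
    ∫ x, (clippedScore Y r δ x - smoothedScore P r x) ^ 2 * smoothedDensity P r x ≤
      (2220 / q ^ 11 + 1536 * (σ / r) ^ 2 / q ^ 19) / r ^ 2 := by
  have hq0 : 0 < q := by linarith
  have mA : MeasurableSet {x | (Y, x) ∈ relevantBadSet P N r q} :=
    measurable_prodMk_left (measurableSet_relevantBadSet hr)
  have j1 : Integrable fun x =>
      (720 / (q ^ 22 * r ^ 3) + 384 * q / r ^ 2 * (1 / (q ^ 22 * r))) *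
        (Set.Icc (μ - r * q ^ 10) (μ + r * q ^ 10)).indicator (1 : ℝ → ℝ) x :=
    ((integrable_indicator_iff measurableSet_Icc).2
      (integrableOn_const (by simp) (by simp))).const_mul _
  have j2 : Integrable fun x => 384 * q / r ^ 2 / (r * q ^ 10) ^ 2 *
      ((x - μ) ^ 2 * smoothedDensity P r x) :=
    (integrable_centered_sq_mul_density hr hP).const_mul _
  have j3 : Integrable fun x => 384 * q / r ^ 2 *
      {x | (Y, x) ∈ relevantBadSet P N r q}.indicator (smoothedDensity P r) x :=
    (integrable_smoothedDensity.indicator mA).const_mul _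
  have j4 : Integrable fun x => 8 / (r ^ 2 * q ^ 24) *
        (Real.exp (r ^ 2 * smoothedScore P r x ^ 2 / 4) * smoothedDensity P r x) :=
    (integrable_exp_score hr).const_mul _
  have j12 := j1.add j2
  have j123 := j12.add j3
  have h := integral_mono_of_nonneg (Filter.Eventually.of_forall fun x =>
      mul_nonneg (sq_nonneg _) (smoothedDensity_pos hr x).le) (j123.add j4)
    (Filter.Eventually.of_forall fun x =>
      sq_clippedScore_sub_mul_density_le (P := P) (μ := μ) hr hq hM Y x)
  refine h.trans ?_
  rw [integral_add' j123 j4, integral_add' j12 j3, integral_add' j1 j2]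
  rw [integral_const_mul, integral_const_mul, integral_const_mul, integral_const_mul,
    integral_indicator_one measurableSet_Icc, Real.volume_real_Icc_of_le (by
      have : 0 < r * q ^ 10 := by positivity
      linarith)]
  have b2 := integral_centered_sq_mul_density_le hr hrσ hP hmean hvar
  have b3 := setIntegral_density_le hr mA (by positivity) hY
  have b4 := integral_exp_score_le (P := P) hr
  -- The window of length `2 r q¹⁰` loses only `q¹⁰` against the pointwise `q⁻²¹`, while outside it
  -- the second moment gives `(σ / r)² q⁻¹⁹`.
  calc _ ≤ (720 / (q ^ 22 * r ^ 3) + 384 * q / r ^ 2 * (1 / (q ^ 22 * r))) *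
        (μ + r * q ^ 10 - (μ - r * q ^ 10)) +
      384 * q / r ^ 2 / (r * q ^ 10) ^ 2 * (4 * σ ^ 2) + 384 * q / r ^ 2 * (q ^ 24)⁻¹ +
      8 / (r ^ 2 * q ^ 24) * (3 / 2) := by gcongr
    _ = (1440 / q ^ 12 + 768 / q ^ 11 + 384 / q ^ 23 + 12 / q ^ 24 +
          1536 * (σ / r) ^ 2 / q ^ 19) / r ^ 2 := by field_simp; ring
    _ ≤ _ := by
      gcongr
      have e12 : 1440 / q ^ 12 ≤ 180 / q ^ 11 := by
        rw [show 1440 / q ^ 12 = (1440 / q) / q ^ 11 by field_simp]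
        gcongr
        rw [div_le_iff₀ hq0]; linarith
      have e23 : 384 / q ^ 23 ≤ 384 / q ^ 11 := by
        gcongr
        · linarith
        · norm_num
      have e24 : 12 / q ^ 24 ≤ 12 / q ^ 11 := by
        gcongr
        · linarith
        · norm_num
      have : 180 / q ^ 11 + 768 / q ^ 11 + 384 / q ^ 11 + 12 / q ^ 11 ≤ 2220 / q ^ 11 := by
        rw [← add_div, ← add_div, ← add_div]; gcongr; norm_num
      linarith

/-- With high probability the kernel density estimate is accurate at most points. -/
lemma measure_relevantBadSet_le (hr : 0 < r) (hN : 0 < N) (hq : 8 ≤ q) :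
    (Measure.pi fun _ : Fin N => P)
      {Y | ENNReal.ofReal (q ^ 24)⁻¹ ≤ smoothedLaw P r {x | (Y, x) ∈ relevantBadSet P N r q}} ≤
    ENNReal.ofReal (4 * Real.exp (-(N * (q ^ 23)⁻¹)) * q ^ 24) := by
  have hq0 : 0 < q := by linarith
  have : Fact (0 < r) := ⟨hr⟩
  refine (measure_le_measure_section_le (p := ENNReal.ofReal (4 * Real.exp (-(N * (q ^ 23)⁻¹))))
    (measurableSet_relevantBadSet hr) (fun x => ?_)
    (ENNReal.ofReal_pos.2 (by positivity)).ne' ENNReal.ofReal_ne_top).trans (le_of_eq ?_)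
  · by_cases hx : (q ^ 22)⁻¹ ≤ r * smoothedDensity P r x
    · refine (measure_mono fun Y hY => hY.1).trans
        (measure_badSet_section_le hr hN (by positivity) x ?_)
      have : (q ^ 23)⁻¹ ≤ (q ^ 22)⁻¹ := by
        gcongr
        · linarith
        · norm_num
      have h0 : 0 < (q ^ 22)⁻¹ := by positivity
      linarith
    · have : {Y : Fin N → ℝ | (Y, x) ∈ relevantBadSet P N r q} = ∅ := by
        ext Y; simp [relevantBadSet, hx]
      rw [this]; simp
  · rw [← ENNReal.ofReal_div_of_pos (by positivity), div_inv_eq_mul]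

end MeanSquare

/-! ### Choice of parameters and conclusion. -/

lemma exists_threshold {ℓ₀ : ℝ} (hℓ₀ : 0 < ℓ₀) :
    ∃ Q : ℝ, 8 ≤ Q ∧ ∀ q, Q ≤ q → Real.log 4 + 24 * Real.log q ≤ (q - 1) * ℓ₀ := by
  have h1 : ∀ᶠ q : ℝ in Filter.atTop, ‖Real.log q‖ ≤ ℓ₀ / 48 * ‖q‖ :=
    Real.isLittleO_log_id_atTop.bound (by positivity)
  have h2 : ∀ᶠ q : ℝ in Filter.atTop, 2 * (Real.log 4 + ℓ₀) / ℓ₀ ≤ q :=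
    Filter.eventually_ge_atTop _
  obtain ⟨Q, hQ⟩ := Filter.eventually_atTop.1 (h1.and h2)
  refine ⟨max Q 8, le_max_right _ _, fun q hq => ?_⟩
  obtain ⟨h3, h4⟩ := hQ q ((le_max_left _ _).trans hq)
  have hq8 : 8 ≤ q := (le_max_right _ _).trans hq
  rw [Real.norm_eq_abs, Real.norm_eq_abs, abs_of_pos (by linarith : 0 < q)] at h3
  have h5 := (le_abs_self _).trans h3
  rw [div_le_iff₀ hℓ₀] at h4
  nlinarith

/-- Here `N q⁻²³ = q log (1/δ)`, so the left side is `4 q²⁴ δ^q`. One factor `δ` is kept and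
`δ^(q-1)` absorbs `4 q²⁴`; this requires `log (1/δ)` to stay away from zero, hence the dependence on
`δ₀`. -/
lemma failure_probability_le {δ ℓ₀ q : ℝ} {N : ℕ} (hδ : 0 < δ) (hℓ : ℓ₀ ≤ Real.log (1 / δ))
    (hℓ₀ : 0 < ℓ₀) (hq : 1 ≤ q) (hQ : Real.log 4 + 24 * Real.log q ≤ (q - 1) * ℓ₀)
    (hM : N / Real.log (1 / δ) = q ^ 24) :
    4 * Real.exp (-(N * (q ^ 23)⁻¹)) * q ^ 24 ≤ δ := by
  have hq0 : 0 < q := by linarith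
  have hNκ : N * (q ^ 23)⁻¹ = q * Real.log (1 / δ) := by
    rw [div_eq_iff (hℓ₀.trans_le hℓ).ne'] at hM
    rw [hM]; field_simp
  have h4 : (4 : ℝ) = Real.exp (Real.log 4) := (Real.exp_log (by norm_num)).symm
  have h24 : q ^ 24 = Real.exp (24 * Real.log q) := by
    rw [show 24 * Real.log q = Real.log (q ^ 24) by rw [Real.log_pow]; push_cast; rfl,
      Real.exp_log (by positivity)]
  have hδe : δ = Real.exp (-Real.log (1 / δ)) := by
    rw [one_div, Real.log_inv, neg_neg, Real.exp_log hδ]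
  have h5 : (q - 1) * ℓ₀ ≤ (q - 1) * Real.log (1 / δ) :=
    mul_le_mul_of_nonneg_left hℓ (by linarith)
  rw [hNκ]
  calc 4 * Real.exp (-(q * Real.log (1 / δ))) * q ^ 24
      = Real.exp (Real.log 4 + -(q * Real.log (1 / δ)) + 24 * Real.log q) := by
        rw [Real.exp_add, Real.exp_add, ← h24, ← h4]
    _ ≤ Real.exp (-Real.log (1 / δ)) := by
        gcongr; linarith
    _ = δ := hδe.symm

/-- The consequences of the sample size condition for `q = M ^ (1 / 24)`, where `ρ = σ / r`. -/
lemma exists_root {γ ρ β M : ℝ} (hγ : 1 ≤ γ) (hρ : 1 ≤ ρ) (hβ : 0 < β)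
    (hM : (γ ^ (5 / 12 : ℝ) * ρ) ^ (6 + β) ≤ M) :
    ∃ q : ℝ, 0 < q ∧ M = q ^ 24 ∧ γ ^ 5 ≤ q ^ 48 ∧ γ * ρ ^ 2 ≤ q ^ 10 ∧ γ * ρ ^ 4 ≤ q ^ 16 := by
  set B := γ ^ (5 / 12 : ℝ) * ρ with hB
  have hγ0 : 0 < γ := by linarith
  have hγ1 : 1 ≤ γ ^ (5 / 12 : ℝ) := Real.one_le_rpow hγ (by norm_num)
  have hρB : ρ ≤ B := by rw [hB]; nlinarith
  have hB1 : 1 ≤ B := hρ.trans hρB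
  -- The twelfth power clears the exponent `5/12`; it matches `q⁴⁸`, since `B⁶ ≤ M = q²⁴`.
  have hB12 : B ^ 12 = γ ^ 5 * ρ ^ 12 := by
    rw [hB, mul_pow, ← Real.rpow_natCast (γ ^ (5 / 12 : ℝ)), ← Real.rpow_mul hγ0.le,
      ← Real.rpow_natCast γ 5]
    norm_num
  have hB6 : B ^ 6 ≤ M := by
    refine le_trans ?_ hM
    rw [← Real.rpow_natCast]
    exact Real.rpow_le_rpow_of_exponent_le hB1 (by push_cast; linarith)
  have hM0 : 0 < M := lt_of_lt_of_le (by positivity) hB6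
  have hq24 : (M ^ (1 / 24 : ℝ)) ^ 24 = M := by
    rw [← Real.rpow_natCast, ← Real.rpow_mul hM0.le]; norm_num
  set q := M ^ (1 / 24 : ℝ) with hq
  have hq0 : 0 < q := Real.rpow_pos_of_pos hM0 _
  have hq4 : B ≤ q ^ 4 := by
    rw [← hq24, show q ^ 24 = (q ^ 4) ^ 6 by ring] at hB6
    exact le_of_pow_le_pow_left₀ (by norm_num) (by positivity) hB6
  have hq1 : 1 ≤ q := by
    by_contra h
    have := pow_lt_one₀ hq0.le (not_le.1 h) (n := 4) (by norm_num)
    linarith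
  have h48 : γ ^ 5 * ρ ^ 12 ≤ q ^ 48 := by
    rw [← hB12, show q ^ 48 = (q ^ 4) ^ 12 by ring]
    gcongr
  refine ⟨q, hq0, hq24.symm, ?_, ?_, ?_⟩
  · exact (le_mul_of_one_le_right (by positivity) (one_le_pow₀ hρ)).trans h48
  · refine le_of_pow_le_pow_left₀ (n := 5) (by norm_num) (by positivity) ?_
    calc (γ * ρ ^ 2) ^ 5 = γ ^ 5 * ρ ^ 10 := by ring
      _ ≤ γ ^ 5 * ρ ^ 12 := by gcongr; norm_num
      _ ≤ q ^ 48 := h48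
      _ ≤ q ^ 50 := pow_le_pow_right₀ hq1 (by norm_num)
      _ = (q ^ 10) ^ 5 := by ring
  -- The surplus `ρ⁸` beyond `γ⁵ ρ¹²` is paid for by `ρ ≤ B ≤ q⁴`.
  · refine le_of_pow_le_pow_left₀ (n := 5) (by norm_num) (by positivity) ?_
    calc (γ * ρ ^ 4) ^ 5 = γ ^ 5 * ρ ^ 12 * ρ ^ 8 := by ring
      _ ≤ q ^ 48 * (q ^ 4) ^ 8 := by gcongr; exact hρB.trans hq4
      _ = (q ^ 16) ^ 5 := by ring

/-- The mean of the symmetrized score, given the mean square error of the clipped score. -/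
lemma abs_integral_symScore_sub_le {P : Measure ℝ} [IsProbabilityMeasure P]
    {μ σ r δ γ ε q : ℝ} {N : ℕ} (hP : MemLp (fun x : ℝ => x) 2 P) (hmean : ∫ x, x ∂P = μ)
    (hvar : variance (fun x : ℝ => x) P = σ ^ 2) (hsym : P.map (fun x : ℝ => 2 * μ - x) = P)
    (hr : 0 < r) (hrσ : r ≤ σ) (hγ : 1 ≤ γ) (hε : |ε| ≤ r / 60)
    (hεI : |ε| ≤ r ^ 2 * √(smoothedFisherInfo P r / γ)) (hq : 8 ≤ q)
    (hM : N / Real.log (1 / δ) = q ^ 24) (hq10 : γ * (σ / r) ^ 2 ≤ q ^ 10)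
    (hq16 : γ * (σ / r) ^ 4 ≤ q ^ 16) (Y : Fin N → ℝ)
    (hY : smoothedLaw P r {x | (Y, x) ∈ relevantBadSet P N r q} ≤ ENNReal.ofReal (q ^ 24)⁻¹) :
    |(∫ x, symScore Y r δ (μ + ε) x ∂(smoothedLaw P r)) - ε * smoothedFisherInfo P r| ≤
      900 * (|ε| * smoothedFisherInfo P r / √γ) := by
  have hq0 : 0 < q := by linarith
  have hγ0 : 0 < γ := by linarith
  have hσ : 0 < σ := by linarith
  have hI1 := one_le_mul_smoothedFisherInfo hr hrσ hP hmean hvar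
  have hJ := integral_sq_clippedScore_sub_le hr hrσ hP hmean hvar hq hM Y hY
  have hε2 : |2 * ε| ≤ r := by rw [abs_mul, abs_two]; linarith
  have hmain := abs_integral_symmetrized_sub_le hr hsym (measurable_clippedScore (δ := δ) hr Y)
    (abs_clippedScore_le hr Y) hε2
  have hI0 := smoothedFisherInfo_nonneg (P := P) (r := r)
  set I := smoothedFisherInfo P r
  set J := ∫ x, (clippedScore Y r δ x - smoothedScore P r x) ^ 2 * smoothedDensity P r x
  have hJ' : J ≤ 4000 / (γ * σ ^ 2) := by
    refine hJ.trans ?_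
    rw [div_le_div_iff₀ (by positivity) (by positivity)]
    have e : (2220 / q ^ 11 + 1536 * (σ / r) ^ 2 / q ^ 19) * (γ * σ ^ 2) =
        (2220 * (γ * (σ / r) ^ 2) / q ^ 11 + 1536 * (γ * (σ / r) ^ 4) / q ^ 19) * r ^ 2 := by
      field_simp
    rw [e]
    gcongr
    calc 2220 * (γ * (σ / r) ^ 2) / q ^ 11 + 1536 * (γ * (σ / r) ^ 4) / q ^ 19
        ≤ 2220 * q ^ 10 / q ^ 11 + 1536 * q ^ 16 / q ^ 19 := by gcongr
      _ ≤ 2220 + 1536 := by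
        gcongr
        · rw [div_le_iff₀ (by positivity)]
          gcongr
          · linarith
          · norm_num
        · rw [div_le_iff₀ (by positivity)]
          gcongr
          · linarith
          · norm_num
      _ ≤ 4000 := by norm_num
  -- The lower bound `1 ≤ 4 σ² I` trades `1 / σ²` for `4 I`.
  have hJ'' : J ≤ 16000 * I / γ := by
    refine hJ'.trans ?_
    rw [div_le_div_iff₀ (by positivity) hγ0]
    nlinarith
  have hε4 : ε ^ 2 / r ^ 4 ≤ I / γ := by
    have := pow_le_pow_left₀ (abs_nonneg _) hεI 2
    rw [sq_abs, mul_pow, Real.sq_sqrt (by positivity), ← pow_mul] at this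
    rw [div_le_iff₀ (by positivity)]
    linarith
  have hIγ : I / γ ≤ I := div_le_self hI0 hγ
  have hfirst : √J * √(8 * ε ^ 2 * I + 32 * (ε ^ 4 / r ^ 4)) ≤ 800 * (|ε| * I / √γ) := by
    rw [← Real.sqrt_mul' _ (by positivity)]
    apply Real.sqrt_le_iff.2 ⟨by positivity, ?_⟩
    -- The squared hypothesis on `ε` gives `ε² / r⁴ ≤ I / γ ≤ I`. The constant 800 then comes from
    -- `800² = 16000 · 40`.
    have h1 : 8 * ε ^ 2 * I + 32 * (ε ^ 4 / r ^ 4) ≤ 40 * ε ^ 2 * I := by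
      have : ε ^ 4 / r ^ 4 = ε ^ 2 * (ε ^ 2 / r ^ 4) := by ring
      rw [this]
      nlinarith [mul_le_mul_of_nonneg_left (hε4.trans hIγ) (sq_nonneg ε)]
    have e : (800 * (|ε| * I / √γ)) ^ 2 = 16000 * I / γ * (40 * ε ^ 2 * I) := by
      rw [mul_pow, div_pow, mul_pow, sq_abs, Real.sq_sqrt hγ0.le]; ring
    rw [e]
    gcongr
  have hsecond : 46 * (ε ^ 2 / r ^ 2) * √I ≤ 46 * (|ε| * I / √γ) := by
    have h1 : |ε| / r ^ 2 ≤ √I / √γ := by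
      rw [← Real.sqrt_div hI0, div_le_iff₀ (by positivity)]; linarith
    calc 46 * (ε ^ 2 / r ^ 2) * √I = 46 * (|ε| * (|ε| / r ^ 2)) * √I := by
          rw [← sq_abs ε]; ring
      _ ≤ 46 * (|ε| * (√I / √γ)) * √I := by gcongr
      _ = 46 * (|ε| * (√I * √I) / √γ) := by ring
      _ = _ := by rw [Real.mul_self_sqrt hI0]
  have hpos : 0 ≤ |ε| * I / √γ := by positivity
  calc _ ≤ √J * √(8 * ε ^ 2 * I + 32 * (ε ^ 4 / r ^ 4)) + 46 * (ε ^ 2 / r ^ 2) * √I := hmain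
    _ ≤ _ := by linarith

end SymKDE

theorem mainTheorem4 (δ₀ : ℝ) (hδ₀ : 0 < δ₀ ∧ δ₀ < 1) :
    ∃ C K : ℝ, 0 < C ∧ 0 < K ∧
      ∀ (P : Measure ℝ) [IsProbabilityMeasure P] (μ σ : ℝ),
        MemLp (fun x : ℝ => x) 2 P →
        (∫ x, x ∂P) = μ →
        variance (fun x : ℝ => x) P = σ ^ 2 →
        P.map (fun x : ℝ => 2 * μ - x) = P →
        ∀ (N : ℕ) (r δ γ β ε : ℝ),
          0 < r → r ≤ σ →
          0 < δ → δ ≤ δ₀ →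
          C < γ → 0 < β →
          (γ ^ (5 / 12 : ℝ) * σ / r) ^ (6 + β) ≤ (N : ℝ) / Real.log (1 / δ) →
          |ε| ≤ r / 60 →
          |ε| ≤ r ^ 2 * √(SymKDE.smoothedFisherInfo P r / γ) →
          Measure.pi (fun _ : Fin N => P)
              {Y : Fin N → ℝ |
                ¬ |(∫ x, SymKDE.symScore Y r δ (μ + ε) x ∂(SymKDE.smoothedLaw P r))
                    - ε * SymKDE.smoothedFisherInfo P r|
                  ≤ K * (|ε| * SymKDE.smoothedFisherInfo P r / √γ)}
            ≤ ENNReal.ofReal δ := by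
  obtain ⟨hδ₀p, hδ₀1⟩ := hδ₀
  have hℓ₀ : 0 < Real.log (1 / δ₀) := Real.log_pos (by rw [lt_div_iff₀ hδ₀p]; linarith)
  obtain ⟨Q, hQ8, hQ⟩ := SymKDE.exists_threshold hℓ₀
  have hQ0 : 0 < Q := by linarith
  -- With `γ > Q¹⁰`, the bound `γ⁵ ≤ q⁴⁸` forces `q ≥ Q`. The constant 900 covers `800 + 46`.
  refine ⟨Q ^ 10, 900, by positivity, by norm_num, ?_⟩
  intro P _ μ σ hP hmean hvar hsym N r δ γ β ε hr hrσ hδ hδδ₀ hγ hβ hN hε hεI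
  have hγ1 : 1 ≤ γ := (one_le_pow₀ (by linarith)).trans hγ.le
  have hρ : 1 ≤ σ / r := by rwa [one_le_div hr]
  have hℓ : Real.log (1 / δ₀) ≤ Real.log (1 / δ) :=
    Real.log_le_log (by positivity) (by gcongr)
  rw [mul_div_assoc] at hN
  obtain ⟨q, hq0, hM, hq48, hq10, hq16⟩ := SymKDE.exists_root hγ1 hρ hβ hN
  have hqQ : Q ≤ q := by
    refine le_of_pow_le_pow_left₀ (n := 48) (by norm_num) hq0.le ?_
    calc Q ^ 48 ≤ Q ^ 50 := pow_le_pow_right₀ (by linarith) (by norm_num)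
      _ = (Q ^ 10) ^ 5 := by ring
      _ ≤ γ ^ 5 := by gcongr
      _ ≤ q ^ 48 := hq48
  have hq8 : 8 ≤ q := hQ8.trans hqQ
  have hN0 : 0 < N := by
    rcases Nat.eq_zero_or_pos N with h | h
    · rw [h, Nat.cast_zero, zero_div] at hM
      exact absurd hM.symm (by positivity)
    · exact h
  calc _ ≤ Measure.pi (fun _ : Fin N => P) {Y | ENNReal.ofReal (q ^ 24)⁻¹ ≤
        SymKDE.smoothedLaw P r {x | (Y, x) ∈ SymKDE.relevantBadSet P N r q}} := by
        refine measure_mono fun Y hY => ?_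
        by_contra hY'
        exact hY (SymKDE.abs_integral_symScore_sub_le hP hmean hvar hsym hr hrσ hγ1 hε hεI hq8 hM
          hq10 hq16 Y (not_le.1 hY').le)
    _ ≤ _ := SymKDE.measure_relevantBadSet_le hr hN0 hq8
    _ ≤ ENNReal.ofReal δ := ENNReal.ofReal_le_ofReal
        (SymKDE.failure_probability_le hδ hℓ hℓ₀ (by linarith) (hQ q hqQ) hM)
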